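/- Let $\alpha,\beta\in\mathbb R$ with $\alpha^2+\beta^2<1$, let $c=\alpha+i\beta$ and $R_2(z)=z^2+c$. Let $\mathcal K$ be the set of $z\in\mathbb C$ whose orbit $R_2^n(z)$ does not tend to $\infty$, and let $\mathcal J=\partial\mathcal K$ be the Julia set. Assume that the critical orbit $\{R_2^n(0)\}$ is bounded and that $R_2$ is hyperbolic: there are $C>0$ and $\lambda>1$ with $|(R_2^n)'(z)|\ge C\lambda^n$ for all $z\in\mathcal J$, $n\ge1$. Then the following holds. There is a unique continuous map $\Phi$ of the unit circle $\mathbb S^1$ onto $\mathcal J$ with $\Phi(z^2)=R_2(\Phi(z))$ that extends continuously to $\{|w|\ge1\}$, holomorphically on $\{|w|>1\}$, so that the extension $\Psi$ satisfies $\Psi(w^2)=R_2(\Psi(w))$ for $|w|\ge1$ and $\Psi(w)/w\to1$ as $w\to\infty$. For $j\in\{1,2\}$ let $Q_j(e^{2\pi i t})=e^{2\pi i (t+j-1)/2}$, $t\in[0,1)$, be the two inverse branches of $z\mapsto z^2$ on $\mathbb S^1$; through $\Phi$ they give the preimage branches of $R_2$ on $\mathcal J$. For every strictly positive probability vector $\vec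 p=(p_1,p_2)$ there is a unique $R_2$-invariant Borel probability measure $\mu_{\vec p}$ with $\mu_{\vec p}(\mathcal J)=1$, the weighted Lyubich measure, which for every $z\in\mathbb S^1$ is the weak limit as $n\to\infty$ of $$\sum_{\eta\in\{1,2\}^n}p_{\eta_1}\cdots p_{\eta_n}\,\delta_{\Phi(Q_{\eta_n}\circ\cdots\circ Q_{\eta_1}(z))}.$$ The function $\log|R_2'|$ is $\mu_{\vec p}$-integrable on $\mathcal J$; put $\Lambda_{\mu_{\vec p}}(R_2)=-\int_{\mathcal J}\log|R_2'|\,d\mu_{\vec p}$. Then $\Lambda_{\mu_{\vec p}}(R_2)$ tends, as $p_1\uparrow1$ and as $p_2\uparrow1$, to one and the same limit $L(\alpha,\beta)$, and $$L(\alpha,\beta)=-\log2+\alpha+\tfrac32(\alpha^2-\beta^2)+O\big((\alpha^2+\beta^2)^{3/2}\big),$$ that is, there is a constant $K$, independent of $\alpha$ and $\beta$, such that for all such $\alpha,\beta$ $$\Big|L(\alpha,\beta)-\big(-\log 2+\alpha+\tfrac32(\alpha^2-\beta^2)\big)\Big|\le K\,(\alpha^2+\beta^2)^{3/2}.$$ 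-/

import Mathlib

open Filter Topology MeasureTheory

noncomputable section

namespace QuadLyap

/-- The points whose orbit under `f` does not tend to infinity. -/
def filledJulia (f : ℂ → ℂ) : Set ℂ :=
  {z | ¬ Tendsto (fun n : ℕ => f^[n] z) atTop (Bornology.cobounded ℂ)}

/-- The Julia set of a polynomial map: the common boundary of the filled Julia set and of its
complement, the basin of infinity. -/
def julia (f : ℂ → ℂ) : Set ℂ := frontier (filledJulia f)

/-- Uniform expansion on the Julia set. -/
def IsHyperbolic (f : ℂ → ℂ) : Prop :=
  ∃ C > (0 : ℝ), ∃ lam > (1 : ℝ), ∀ z ∈ julia f, ∀ n : ℕ, 1 ≤ n →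
    C * lam ^ n ≤ ‖deriv (f^[n]) z‖

/-- Every critical point has a bounded forward orbit. -/
def HasBoundedCriticalOrbit (f : ℂ → ℂ) : Prop :=
  ∀ z : ℂ, deriv f z = 0 → Bornology.IsBounded (Set.range fun n : ℕ => f^[n] z)

/-- The quadratic polynomial `z ^ 2 + (α + i β)`. -/
def R₂ (α β : ℝ) (z : ℂ) : ℂ := z ^ 2 + ((α : ℂ) + (β : ℂ) * Complex.I)

/-- `Φ` is the normalised parametrisation of the Julia set of the monic degree `d` polynomial map
`f` by the unit circle: a continuous map of the circle onto the Julia set, carrying `z ↦ z ^ d` to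
`f`, and normalised (for `z ^ 2 + c` this excludes e.g. precomposition with complex conjugation) by
the requirement that it extends to `1 ≤ |w|`, holomorphically on `1 < |w|` and tangent to the
identity at infinity. Injectivity is not imposed: it holds only if the Julia set is a Jordan
curve. -/
structure IsCircleConjugacy (d : ℕ) (f : ℂ → ℂ) (Φ : Circle → ℂ) : Prop where
  continuous : Continuous Φ
  range_eq : Set.range Φ = julia f
  semiconj : ∀ z : Circle, Φ (z ^ d) = f (Φ z)
  normalised : ∃ Ψ : ℂ → ℂ,
    ContinuousOn Ψ {w | 1 ≤ ‖w‖} ∧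
    DifferentiableOn ℂ Ψ {w | 1 < ‖w‖} ∧
    (∀ w : ℂ, 1 ≤ ‖w‖ → Ψ (w ^ d) = f (Ψ w)) ∧
    Tendsto (fun w : ℂ => Ψ w / w) (Bornology.cobounded ℂ) (𝓝 1) ∧
    ∀ z : Circle, Ψ (z : ℂ) = Φ z

/-- A strictly positive probability vector. -/
def IsPosProbVec {d : ℕ} (p : Fin d → ℝ) : Prop := (∀ j, 0 < p j) ∧ ∑ j, p j = 1

/-- The inverse branch of `z ↦ z ^ d` with values in the arc `[j / d, (j + 1) / d)` of the circle,
in the coordinate `t ∈ [0, 1)` of the point `exp (2 π i t)`. -/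
def branch (d : ℕ) (j : Fin d) (t : ℝ) : ℝ := (t + (j : ℕ)) / d

/-- The branch of a word: the first letter is applied first. -/
def wordBranch (d : ℕ) : (n : ℕ) → (Fin n → Fin d) → ℝ → ℝ
  | 0, _, t => t
  | n + 1, η, t => branch d (η (Fin.last n)) (wordBranch d n (fun i => η i.castSucc) t)

/-- The weighted sum of the point masses at the `n`-th order preimages of the point
`ζ = Φ (exp (2 π i t))` of the Julia set; the preimage with the word `η` has the weight
`p (η 0) * ⋯ * p (η (n - 1))`. -/
def preimageMeasure {d : ℕ} (Φ : Circle → ℂ) (p : Fin d → ℝ) (t : ℝ) (n : ℕ) : Measure ℂ :=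
  ∑ η : Fin n → Fin d, ENNReal.ofReal (∏ i, p (η i)) •
    Measure.dirac (Φ (Circle.exp (2 * Real.pi * wordBranch d n η t)))

/-- `μ` is the weighted Lyubich measure of `f` with weights `p`: an invariant probability measure on
the Julia set that is the weak limit of the weighted preimage measures, whatever the base point. -/
structure IsWeightedLyubich {d : ℕ} (f : ℂ → ℂ) (Φ : Circle → ℂ) (p : Fin d → ℝ)
    (μ : Measure ℂ) : Prop where
  isProbabilityMeasure : IsProbabilityMeasure μ
  supported : μ (julia f)ᶜ = 0
  invariant : μ.map f = μ
  tendsto : ∀ t ∈ Set.Ico (0 : ℝ) 1, ∀ g : BoundedContinuousFunction ℂ ℝ,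
    Tendsto (fun n : ℕ => ∫ z, g z ∂(preimageMeasure Φ p t n)) atTop (𝓝 (∫ z, g z ∂μ))

/-- The Lyapunov exponent, with the sign convention `Λ = - ∫ log |f'| dμ`. -/
def lyapunov (f : ℂ → ℂ) (μ : Measure ℂ) : ℝ :=
  - ∫ z in julia f, Real.log ‖deriv f z‖ ∂μ

/-- The strictly positive probability vectors `p` with `p j ↑ 1`. -/
def weightToOne {d : ℕ} (j : Fin d) : Filter (Fin d → ℝ) :=
  comap (fun p => p j) (𝓝[<] 1) ⊓ 𝓟 {p | IsPosProbVec p}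

end QuadLyap

end

/-! Write c = α + iβ. In the coordinate s = 1/w, the conjugacy of w² with z² + c at infinity is ψ(s)
= g(s)/s, where g(0) = 1 and g(s)² = g(s²) - c s². Near 0, g is a limit of iterated square roots. A
solution on radius r² extends to radius r by one further root, because the radicand vanishes only if
the critical value c escapes (`IsBoettcher.exists_extend`). So g lives on the whole unit disc, and ψ
maps the punctured disc onto the basin of infinity (`IsBoettcher.surj`).

Hyperbolicity bounds the growth of s ψ'(s) towards the circle (`IsBoettcher.exists_deriv_bound`):
the increments of ψ along radii are geometrically small, so ψ extends continuously to the circle,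
with image the Julia set (`IsBoettcher.exists_extension`, `IsBoettcher.range_extension`). Uniqueness
of Φ is uniqueness of g together with density.

In the angle coordinate, the weighted preimages converge to the law of a random binary number with
independent digits of weights p (`exists_isDigitMeasure`); the Lyubich measure is its image under Φ.
Since the mean of that law is the weight of the digit 1, it concentrates at the endpoint j of [0, 1]
as p j tends to 1. Both endpoints are the angle of the point 1, so both limits equal -log |2b|,
where b = Φ(1) is a fixed point. Hyperbolicity gives |2b| > 1, which for small c selects the root b
near 1, and a Taylor expansion of its logarithm finishes the proof. -/

namespace QuadLyap
open Metric Set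

/-! ### The Böttcher function: uniqueness, and existence near infinity -/

/-- `g` is the Böttcher function of `z ↦ z ^ 2 + c` at infinity in the coordinate `s = 1 / w`:
`w ↦ w * g (1 / w)` is tangent to the identity at infinity and conjugates `w ↦ w ^ 2` to
`z ↦ z ^ 2 + c`. -/
structure IsBoettcher (c : ℂ) (r : ℝ) (g : ℂ → ℂ) : Prop where
  differentiableOn : DifferentiableOn ℂ g (ball 0 r)
  map_zero : g 0 = 1
  sq_eq : ∀ s ∈ ball (0 : ℂ) r, g s ^ 2 = g (s ^ 2) - c * s ^ 2

lemma sq_mem_ball {r : ℝ} (hr : r ≤ 1) {s : ℂ} (hs : s ∈ ball (0 : ℂ) r) : s ^ 2 ∈ ball (0 : ℂ) r := by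
  rw [mem_ball_zero_iff] at *
  rw [norm_pow]
  nlinarith [norm_nonneg s, hr]

lemma IsBoettcher.mono {c : ℂ} {r r' : ℝ} {g : ℂ → ℂ} (h : IsBoettcher c r g) (hr : r' ≤ r) :
    IsBoettcher c r' g :=
  ⟨h.differentiableOn.mono (ball_subset_ball hr), h.map_zero,
    fun s hs => h.sq_eq s (ball_subset_ball hr hs)⟩

/-- Near 0 both functions are close to 1, so their sum has modulus at least 3/2. The difference of
their squares at s is their difference at s², so the difference shrinks by 2/3 at each use of the
equation. The identity theorem then covers the disc. -/
lemma IsBoettcher.eqOn {c : ℂ} {r : ℝ} {g₁ g₂ : ℂ → ℂ} (hr0 : 0 < r)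
    (h₁ : IsBoettcher c r g₁) (h₂ : IsBoettcher c r g₂) : EqOn g₁ g₂ (ball 0 r) := by
  have near : ∀ g, IsBoettcher c r g → ∀ᶠ s in 𝓝 (0 : ℂ), ‖g s - 1‖ < 1 / 4 := by
    intro g hg
    have hc : ContinuousAt g 0 :=
      (hg.differentiableOn.differentiableAt (ball_mem_nhds 0 hr0)).continuousAt
    have := Metric.tendsto_nhds.1 hc.tendsto (1 / 4) (by norm_num)
    simpa [hg.map_zero, dist_eq_norm] using this
  obtain ⟨δ, hδ, hball⟩ := Metric.eventually_nhds_iff_ball.1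
    ((near g₁ h₁).and ((near g₂ h₂).and (ball_mem_nhds (0 : ℂ) hr0)))
  have hmin : min δ 1 ≤ 1 := min_le_right _ _
  have key : ∀ n : ℕ, ∀ s ∈ ball (0 : ℂ) (min δ 1), ‖g₁ s - g₂ s‖ ≤ (2 / 3) ^ n := by
    intro n
    induction n with
    | zero =>
      intro s hs
      obtain ⟨a, b, -⟩ := hball s (ball_subset_ball (min_le_left _ _) hs)
      have : g₁ s - g₂ s = (g₁ s - 1) - (g₂ s - 1) := by ring
      rw [this, pow_zero]
      exact (norm_sub_le _ _).trans (by linarith)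
    | succ n ih =>
      intro s hs
      obtain ⟨a, b, hsr⟩ := hball s (ball_subset_ball (min_le_left _ _) hs)
      have e : (g₁ s - g₂ s) * (g₁ s + g₂ s) = g₁ (s ^ 2) - g₂ (s ^ 2) := by
        linear_combination h₁.sq_eq s hsr - h₂.sq_eq s hsr
      have i := ih (s ^ 2) (sq_mem_ball hmin hs)
      rw [← e, norm_mul] at i
      have low : (3 / 2 : ℝ) ≤ ‖g₁ s + g₂ s‖ := by
        have h2 : (2 : ℂ) = (g₁ s + g₂ s) - ((g₁ s - 1) + (g₂ s - 1)) := by ring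
        have : ‖(2 : ℂ)‖ ≤ ‖g₁ s + g₂ s‖ + (‖g₁ s - 1‖ + ‖g₂ s - 1‖) := by
          conv_lhs => rw [h2]
          exact (norm_sub_le _ _).trans (by gcongr; exact norm_add_le _ _)
        norm_num at this
        linarith
      rw [pow_succ]
      nlinarith [norm_nonneg (g₁ s - g₂ s)]
  have hev : g₁ =ᶠ[𝓝 0] g₂ := by
    filter_upwards [ball_mem_nhds (0 : ℂ) (lt_min hδ one_pos)] with s hs
    have : ‖g₁ s - g₂ s‖ ≤ 0 :=
      ge_of_tendsto' (tendsto_pow_atTop_nhds_zero_of_lt_one (by norm_num) (by norm_num))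
        (fun n => key n s hs)
    exact sub_eq_zero.1 (norm_le_zero_iff.1 this)
  exact (h₁.differentiableOn.analyticOnNhd isOpen_ball).eqOn_of_preconnected_of_eventuallyEq
    (h₂.differentiableOn.analyticOnNhd isOpen_ball) (convex_ball _ _).isPreconnected
    (mem_ball_self hr0) hev

/-- The iteration whose limit is the Böttcher function near the origin. -/
noncomputable def boettcherApprox (c : ℂ) : ℕ → ℂ → ℂ
  | 0, _ => 1
  | n + 1, s => (boettcherApprox c n (s ^ 2) - c * s ^ 2) ^ (2⁻¹ : ℂ)

/-- The principal root q has nonnegative real part, so |q + 1| ≥ 1 in u - 1 = (q - 1)(q + 1). -/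
lemma norm_cpow_half_sub_one_le (u : ℂ) : ‖u ^ (2⁻¹ : ℂ) - 1‖ ≤ ‖u - 1‖ := by
  set q := u ^ (2⁻¹ : ℂ) with hq
  have h2 : q ^ 2 = u := by
    exact_mod_cast Complex.cpow_nat_inv_pow u (n := 2) two_ne_zero
  have hre : 0 ≤ q.re := by rw [hq, Complex.cpow_inv_two_re]; positivity
  have : u - 1 = (q - 1) * (q + 1) := by rw [← h2]; ring
  rw [this, norm_mul]
  have : 1 ≤ ‖q + 1‖ := by
    have := Complex.re_le_norm (q + 1)
    simp at this
    linarith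
  exact le_mul_of_one_le_right (norm_nonneg _) this

/-- The bound reproduces itself: 2|s|⁴ + |s|² ≤ 2|s|² on this disc. It keeps every radicand in the
right half-plane, where the principal root is holomorphic. -/
lemma norm_boettcherApprox_sub_one_le {c : ℂ} (hc : ‖c‖ ≤ 1) (n : ℕ) :
    ∀ s ∈ ball (0 : ℂ) (1 / 4), ‖boettcherApprox c n s - 1‖ ≤ 2 * ‖s‖ ^ 2 := by
  induction n with
  | zero => intro s _; simp [boettcherApprox]
  | succ n ih =>
    intro s hs
    have i := ih (s ^ 2) (sq_mem_ball (by norm_num) hs)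
    rw [mem_ball_zero_iff] at hs
    refine (norm_cpow_half_sub_one_le _).trans ?_
    have : boettcherApprox c n (s ^ 2) - c * s ^ 2 - 1
      = (boettcherApprox c n (s ^ 2) - 1) - c * s ^ 2 := by ring
    rw [this]
    refine (norm_sub_le _ _).trans ?_
    rw [norm_mul, norm_pow]
    rw [norm_pow] at i
    have h1 : ‖s‖ ^ 2 ≤ 1 / 16 := by nlinarith [norm_nonneg s]
    have h2 : ‖c‖ * ‖s‖ ^ 2 ≤ ‖s‖ ^ 2 := mul_le_of_le_one_left (by positivity) hc
    nlinarith [sq_nonneg ‖s‖]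

lemma boettcherApprox_arg_re_pos {c : ℂ} (hc : ‖c‖ ≤ 1) (n : ℕ) {s : ℂ}
    (hs : s ∈ ball (0 : ℂ) (1 / 4)) : 0 < (boettcherApprox c n (s ^ 2) - c * s ^ 2).re := by
  have i := norm_boettcherApprox_sub_one_le hc n (s ^ 2) (sq_mem_ball (by norm_num) hs)
  rw [mem_ball_zero_iff] at hs
  have h1 : ‖s‖ ^ 2 ≤ 1 / 16 := by nlinarith [norm_nonneg s]
  have h2 : ‖c‖ * ‖s‖ ^ 2 ≤ ‖s‖ ^ 2 := mul_le_of_le_one_left (by positivity) hc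
  have h3 : ‖(boettcherApprox c n (s ^ 2) - 1) - c * s ^ 2‖ ≤ 1 / 2 := by
    refine (norm_sub_le _ _).trans ?_
    rw [norm_mul, norm_pow]
    rw [norm_pow] at i
    nlinarith [sq_nonneg ‖s‖]
  have h4 := (abs_le.1 ((Complex.abs_re_le_norm _).trans h3)).1
  simp only [Complex.sub_re, Complex.one_re] at h4 ⊢
  linarith

lemma differentiableOn_boettcherApprox {c : ℂ} (hc : ‖c‖ ≤ 1) (n : ℕ) :
    DifferentiableOn ℂ (boettcherApprox c n) (ball 0 (1 / 4)) := by
  induction n with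
  | zero => exact differentiableOn_const _
  | succ n ih =>
    have hcomp : DifferentiableOn ℂ (fun s => boettcherApprox c n (s ^ 2)) (ball 0 (1 / 4)) :=
      ih.comp (by fun_prop) fun s hs => sq_mem_ball (by norm_num) hs
    exact (hcomp.sub (by fun_prop)).cpow_const
      fun s hs => Or.inl (boettcherApprox_arg_re_pos hc n hs)

lemma boettcherApprox_succ_sq (c : ℂ) (n : ℕ) (s : ℂ) :
    boettcherApprox c (n + 1) s ^ 2 = boettcherApprox c n (s ^ 2) - c * s ^ 2 := by
  rw [boettcherApprox]
  generalize boettcherApprox c n (s ^ 2) - c * s ^ 2 = u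
  exact_mod_cast Complex.cpow_nat_inv_pow u two_ne_zero

/-- The contraction by 2/3 from the uniqueness proof, applied to consecutive approximations. -/
lemma norm_boettcherApprox_succ_sub_le {c : ℂ} (hc : ‖c‖ ≤ 1) (n : ℕ) :
    ∀ s ∈ ball (0 : ℂ) (1 / 4),
      ‖boettcherApprox c (n + 1) s - boettcherApprox c n s‖ ≤ (2 / 3) ^ n := by
  have near : ∀ n, ∀ s ∈ ball (0 : ℂ) (1 / 4), ‖boettcherApprox c n s - 1‖ ≤ 1 / 4 := by
    intro n s hs
    have := norm_boettcherApprox_sub_one_le hc n s hs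
    rw [mem_ball_zero_iff] at hs
    nlinarith [norm_nonneg s]
  induction n with
  | zero =>
    intro s hs
    have := near 1 s hs
    simp only [boettcherApprox, pow_zero] at this ⊢
    linarith
  | succ n ih =>
    intro s hs
    have i := ih (s ^ 2) (sq_mem_ball (by norm_num) hs)
    have e : (boettcherApprox c (n + 2) s - boettcherApprox c (n + 1) s) *
        (boettcherApprox c (n + 2) s + boettcherApprox c (n + 1) s) =
        boettcherApprox c (n + 1) (s ^ 2) - boettcherApprox c n (s ^ 2) := by
      linear_combination boettcherApprox_succ_sq c (n + 1) s - boettcherApprox_succ_sq c n s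
    rw [← e, norm_mul] at i
    have a := near (n + 2) s hs
    have b := near (n + 1) s hs
    generalize boettcherApprox c (n + 2) s = x at *
    generalize boettcherApprox c (n + 1) s = y at *
    have low : (3 / 2 : ℝ) ≤ ‖x + y‖ := by
      have h2 : (2 : ℂ) = (x + y) - ((x - 1) + (y - 1)) := by ring
      have : ‖(2 : ℂ)‖ ≤ ‖x + y‖ + (‖x - 1‖ + ‖y - 1‖) := by
        conv_lhs => rw [h2]
        exact (norm_sub_le _ _).trans (by gcongr; exact norm_add_le _ _)
      norm_num at this
      linarith
    rw [pow_succ]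
    nlinarith [norm_nonneg (x - y)]

lemma boettcherApprox_zero (c : ℂ) (n : ℕ) : boettcherApprox c n 0 = 1 := by
  induction n with
  | zero => rfl
  | succ n ih => simp [boettcherApprox, ih]

lemma exists_isBoettcher_local {c : ℂ} (hc : ‖c‖ ≤ 1) : ∃ g, IsBoettcher c (1 / 4) g := by
  have hsum : Summable fun n : ℕ => (2 / 3 : ℝ) ^ n :=
    summable_geometric_of_lt_one (by norm_num) (by norm_num)
  set D : ℕ → ℂ → ℂ := fun n s => boettcherApprox c (n + 1) s - boettcherApprox c n s
  have hlim : ∀ s ∈ ball (0 : ℂ) (1 / 4),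
      Tendsto (fun n => boettcherApprox c n s) atTop (𝓝 (1 + ∑' n, D n s)) := by
    intro s hs
    have h1 : Summable fun n => D n s :=
      Summable.of_norm_bounded hsum fun n => norm_boettcherApprox_succ_sub_le hc n s hs
    have h2 := h1.hasSum.tendsto_sum_nat.const_add 1
    refine h2.congr fun n => ?_
    rw [Finset.sum_range_sub (fun n => boettcherApprox c n s)]
    simp [boettcherApprox]
  refine ⟨fun s => 1 + ∑' n, D n s, ?_, ?_, ?_⟩
  · refine (differentiableOn_const (1 : ℂ)).add ?_
    exact Complex.differentiableOn_tsum_of_summable_norm hsum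
      (fun n => (differentiableOn_boettcherApprox hc _).sub (differentiableOn_boettcherApprox hc _))
      isOpen_ball fun n s hs => norm_boettcherApprox_succ_sub_le hc n s hs
  · simp [D, boettcherApprox_zero]
  · intro s hs
    refine tendsto_nhds_unique (((tendsto_add_atTop_iff_nat 1).2 (hlim s hs)).pow 2) ?_
    simp_rw [boettcherApprox_succ_sq]
    exact (hlim _ (sq_mem_ball (by norm_num) hs)).sub_const _

/-! ### Continuation of the Böttcher function to the unit disc -/

/-- The quadratic polynomial `z ^ 2 + c`. -/
def quad (c z : ℂ) : ℂ := z ^ 2 + c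

lemma pow_two_pow_mem_ball {r : ℝ} (hr : r ≤ 1) {s : ℂ} (hs : s ∈ ball (0 : ℂ) r) (n : ℕ) :
    s ^ 2 ^ n ∈ ball (0 : ℂ) r := by
  induction n with
  | zero => simpa using hs
  | succ n ih => rw [pow_succ, pow_mul]; exact sq_mem_ball hr ih

lemma IsBoettcher.iterate_quad {c : ℂ} {r : ℝ} {g : ℂ → ℂ} (hr : r ≤ 1) (h : IsBoettcher c r g)
    {s : ℂ} (hs : s ∈ ball (0 : ℂ) r) (h0 : s ≠ 0) (n : ℕ) :
    (quad c)^[n] (g s / s) = g (s ^ 2 ^ n) / s ^ 2 ^ n := by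
  induction n with
  | zero => simp
  | succ n ih =>
    rw [Function.iterate_succ_apply', ih, quad, div_pow, h.sq_eq _ (pow_two_pow_mem_ball hr hs n)]
    have : s ^ 2 ^ n ≠ 0 := pow_ne_zero _ h0
    rw [pow_succ 2 n, pow_mul]
    field_simp
    ring

lemma tendsto_pow_two_pow {s : ℂ} (hs : ‖s‖ < 1) :
    Tendsto (fun n : ℕ => s ^ 2 ^ n) atTop (𝓝 0) :=
  (tendsto_pow_atTop_nhds_zero_of_norm_lt_one hs).comp
    (tendsto_pow_atTop_atTop_of_one_lt one_lt_two)

lemma IsBoettcher.tendsto_div_cobounded {c : ℂ} {r : ℝ} {g : ℂ → ℂ} (hr0 : 0 < r)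
    (h : IsBoettcher c r g) : Tendsto (fun s => g s / s) (𝓝[≠] 0) (Bornology.cobounded ℂ) := by
  have hc : ContinuousAt g 0 :=
    (h.differentiableOn.differentiableAt (ball_mem_nhds 0 hr0)).continuousAt
  rw [← tendsto_norm_atTop_iff_cobounded]
  have h1 : Tendsto (fun s => ‖g s‖) (𝓝[≠] 0) (𝓝 1) := by
    simpa [h.map_zero] using hc.norm.tendsto.mono_left nhdsWithin_le_nhds
  have h2 : Tendsto (fun s : ℂ => ‖s‖⁻¹) (𝓝[≠] 0) atTop := by
    simpa only [← norm_inv, Function.comp_def] using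
      tendsto_norm_cobounded_atTop.comp (tendsto_inv₀_nhdsNE_zero (α := ℂ))
  simpa [norm_div, div_eq_mul_inv] using h1.pos_mul_atTop one_pos h2

lemma IsBoettcher.tendsto_iterate {c : ℂ} {r : ℝ} {g : ℂ → ℂ} (hr0 : 0 < r) (hr : r ≤ 1)
    (h : IsBoettcher c r g) {s : ℂ} (hs : s ∈ ball (0 : ℂ) r) (h0 : s ≠ 0) :
    Tendsto (fun n => (quad c)^[n] (g s / s)) atTop (Bornology.cobounded ℂ) := by
  simp_rw [h.iterate_quad hr hs h0]
  refine (h.tendsto_div_cobounded hr0).comp (tendsto_nhdsWithin_iff.2 ⟨tendsto_pow_two_pow ?_, ?_⟩)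
  · exact (mem_ball_zero_iff.1 hs).trans_le hr
  · exact .of_forall fun n => pow_ne_zero _ h0

lemma isSimplyConnected_ball {r : ℝ} (hr : 0 < r) : IsSimplyConnected (ball (0 : ℂ) r) := by
  have := (convex_ball (0 : ℂ) r).contractibleSpace ⟨0, mem_ball_self hr⟩
  exact (inferInstance : SimplyConnectedSpace (ball (0 : ℂ) r))

/-- The radicand g(s²) - c s² makes sense for |s| < r. A zero of it would give g(s²)/s² = c, a point
that escapes, against `hcrit`; so it has a continuous square root on the simply connected disc. -/
lemma IsBoettcher.exists_extend {c : ℂ} {r : ℝ} {g : ℂ → ℂ} (hr0 : 0 < r) (hr : r ≤ 1)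
    (h : IsBoettcher c (r ^ 2) g)
    (hcrit : ¬ Tendsto (fun n => (quad c)^[n] c) atTop (Bornology.cobounded ℂ)) :
    ∃ g', IsBoettcher c r g' := by
  have hr2 : r ^ 2 ≤ 1 := by nlinarith
  have hr2' : r ^ 2 ≤ r := by nlinarith
  have hsq : ∀ s ∈ ball (0 : ℂ) r, s ^ 2 ∈ ball (0 : ℂ) (r ^ 2) := by
    intro s hs
    rw [mem_ball_zero_iff] at *
    rw [norm_pow]
    gcongr
  set u : ℂ → ℂ := fun s => g (s ^ 2) - c * s ^ 2
  have hu : DifferentiableOn ℂ u (ball 0 r) :=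
    (h.differentiableOn.comp (by fun_prop) hsq).sub (by fun_prop)
  have hu0 : ∀ s ∈ ball (0 : ℂ) r, u s ≠ 0 := by
    intro s hs hus
    rcases eq_or_ne s 0 with rfl | h0
    · simp [u, h.map_zero] at hus
    · apply hcrit
      have := h.tendsto_iterate (by positivity) hr2 (hsq s hs) (pow_ne_zero 2 h0)
      have e : g (s ^ 2) / s ^ 2 = c := by
        rw [div_eq_iff (pow_ne_zero 2 h0)]
        exact sub_eq_zero.1 hus
      rwa [e] at this
  obtain ⟨q, hqc, hq⟩ := Complex.exists_continuousOn_pow_eq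
    (isSimplyConnected_ball hr0) isOpen_ball hu.continuousOn
    (by rintro ⟨s, hs, e⟩; exact hu0 s hs e) two_ne_zero
  -- A continuous root of a nonvanishing holomorphic function is holomorphic: the slope of q is the
  -- slope of u divided by q z + q s.
  have hqd : DifferentiableOn ℂ q (ball 0 r) := by
    intro s hs
    have hq0 : q s ≠ 0 := fun e => hu0 s hs (by rw [← hq, e]; simp)
    have hqs : ContinuousAt q s := hqc.continuousAt (isOpen_ball.mem_nhds hs)
    have hd : HasDerivAt (fun z : ℂ => z ^ 2) (2 * q s) (q s) := by
      simpa using hasDerivAt_pow 2 (q s)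
    have hus := (hu.differentiableAt (isOpen_ball.mem_nhds hs)).hasDerivAt
    have hslope : Tendsto (slope q s) (𝓝[≠] s) (𝓝 (deriv u s / (2 * q s))) := by
      have h1 := hus.tendsto_slope
      have h2 : Tendsto (fun z => q z + q s) (𝓝[≠] s) (𝓝 (2 * q s)) := by
        rw [two_mul]
        exact (hqs.tendsto.mono_left nhdsWithin_le_nhds).add_const _
      have h3 := h1.div h2 (by simpa using hq0)
      refine h3.congr' ?_
      filter_upwards [h2.eventually_ne (by simpa using hq0 : 2 * q s ≠ 0), self_mem_nhdsWithin]
        with z hz hzs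
      have hzs' : z - s ≠ 0 := sub_ne_zero.2 hzs
      simp only [slope_def_field, Pi.div_apply, ← hq]
      field_simp
      ring
    exact (hasDerivAt_iff_tendsto_slope.2 hslope).differentiableAt.differentiableWithinAt
  have hq0 : q 0 ≠ 0 := fun e => hu0 0 (mem_ball_self hr0) (by rw [← hq, e]; simp)
  have hq1 : q 0 ^ 2 = 1 := by rw [hq]; simp [u, h.map_zero]
  -- The root may take the value -1 at 0; dividing by `q 0` normalises it without changing its
  -- square.
  set p : ℂ → ℂ := fun s => q s / q 0
  have hpd : DifferentiableOn ℂ p (ball 0 r) := hqd.div_const _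
  have hp0 : p 0 = 1 := div_self hq0
  have hp : ∀ s, p s ^ 2 = u s := by intro s; simp [p, div_pow, hq1, hq]
  -- On the small disc p and g are square roots of the same nonvanishing function and agree at 0.
  -- Hence g may be replaced by p at s² in the equation.
  have hpg : EqOn p g (ball 0 (r ^ 2)) := by
    have hsub : ball (0 : ℂ) (r ^ 2) ⊆ ball 0 r := ball_subset_ball hr2'
    have hz : (0 : ℂ) ∈ ball (0 : ℂ) (r ^ 2) := mem_ball_self (by positivity)
    refine (isPreconnected_of_forall_pair fun x hx y hy => ?_ : IsPreconnected
      (ball (0 : ℂ) (r ^ 2))).eq_of_sq_eq (hpd.continuousOn.mono hsub)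
      h.differentiableOn.continuousOn ?_ ?_ hz ?_
    · exact ⟨_, Subset.rfl, hx, hy, (convex_ball _ _).isPreconnected⟩
    · intro s hs
      simp only [Pi.pow_apply]
      rw [hp, h.sq_eq s hs]
    · intro s hs e
      have := hu0 s (hsub hs)
      rw [← hp, ] at this
      apply this
      rw [hp]
      have := h.sq_eq s hs
      rw [e] at this
      simpa using this.symm
    · rw [hp0, h.map_zero]
  refine ⟨p, hpd, hp0, fun s hs => ?_⟩
  rw [hp, hpg (hsq s hs)]

lemma exists_isBoettcher_of_pow_le {c : ℂ} (hc : ‖c‖ ≤ 1)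
    (hcrit : ¬ Tendsto (fun n => (quad c)^[n] c) atTop (Bornology.cobounded ℂ)) (n : ℕ) :
    ∀ r : ℝ, 0 < r → r ≤ 1 → r ^ 2 ^ n ≤ 1 / 4 → ∃ g, IsBoettcher c r g := by
  induction n with
  | zero =>
    intro r h0 h1 h
    obtain ⟨g, hg⟩ := exists_isBoettcher_local hc
    exact ⟨g, hg.mono (by simpa using h)⟩
  | succ n ih =>
    intro r h0 h1 h
    obtain ⟨g, hg⟩ := ih (r ^ 2) (by positivity) (by nlinarith) (by rwa [← pow_mul, ← pow_succ'])
    exact hg.exists_extend h0 h1 hcrit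

lemma exists_isBoettcher {c : ℂ} (hc : ‖c‖ ≤ 1)
    (hcrit : ¬ Tendsto (fun n => (quad c)^[n] c) atTop (Bornology.cobounded ℂ)) :
    ∃ g, IsBoettcher c 1 g := by
  have hex : ∀ r : ℝ, 0 < r → r < 1 → ∃ g, IsBoettcher c r g := by
    intro r h0 h1
    have ht : Tendsto (fun n : ℕ => r ^ 2 ^ n) atTop (𝓝 0) :=
      (tendsto_pow_atTop_nhds_zero_of_lt_one h0.le h1).comp
        (tendsto_pow_atTop_atTop_of_one_lt one_lt_two)
    obtain ⟨n, hn⟩ := (ht.eventually (ge_mem_nhds (by norm_num : (0 : ℝ) < 1 / 4))).exists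
    exact exists_isBoettcher_of_pow_le hc hcrit n r h0 h1.le hn
  choose! G hG using hex
  -- A radius strictly between |s| and 1; by uniqueness the value at s does not depend on this
  -- choice.
  set R : ℂ → ℝ := fun s => (1 + ‖s‖) / 2
  have hR0 : ∀ s, 0 < R s := fun s => by positivity
  have hR1 : ∀ s ∈ ball (0 : ℂ) 1, R s < 1 := fun s hs => by
    have := mem_ball_zero_iff.1 hs
    simp only [R]; linarith
  have hsR : ∀ s ∈ ball (0 : ℂ) 1, s ∈ ball (0 : ℂ) (R s) := fun s hs => by
    have := mem_ball_zero_iff.1 hs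
    simp only [R, mem_ball_zero_iff]; linarith
  have agree : ∀ r, 0 < r → r < 1 → ∀ s ∈ ball (0 : ℂ) r, G (R s) s = G r s := by
    intro r h0 h1 s hs
    have hs1 : s ∈ ball (0 : ℂ) 1 := ball_subset_ball h1.le hs
    have hm : 0 < min r (R s) := lt_min h0 (hR0 s)
    refine IsBoettcher.eqOn hm
      ((hG _ (hR0 s) (hR1 s hs1)).mono (min_le_right _ _)) ((hG r h0 h1).mono (min_le_left _ _)) ?_
    rw [mem_ball_zero_iff] at *
    exact lt_min hs (by simpa using hsR s (by simpa using hs1))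
  refine ⟨fun s => G (R s) s, ?_, ?_, ?_⟩
  · intro s hs
    have hb := isOpen_ball.mem_nhds (hsR s hs)
    have hd := (hG _ (hR0 s) (hR1 s hs)).differentiableOn.differentiableAt hb
    refine (hd.congr_of_eventuallyEq ?_).differentiableWithinAt
    filter_upwards [hb] with z hz
    exact agree _ (hR0 s) (hR1 s hs) z hz
  · exact (hG _ (hR0 0) (hR1 0 (by simp))).map_zero
  · intro s hs
    have h1 := hG _ (hR0 s) (hR1 s hs)
    rw [h1.sq_eq s (hsR s hs), ← agree _ (hR0 s) (hR1 s hs) (s ^ 2)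
      (sq_mem_ball (hR1 s hs).le (hsR s hs))]

end QuadLyap

namespace QuadLyap
open Metric Set

/-! ### Escape radius 2 and the filled Julia set -/

lemma continuous_quad (c : ℂ) : Continuous (quad c) := by unfold quad; fun_prop

lemma norm_quad_ge {c : ℂ} (hc : ‖c‖ ≤ 1) {z : ℂ} (hz : 2 ≤ ‖z‖) :
    3 / 2 * ‖z‖ ≤ ‖quad c z‖ := by
  have h1 : ‖z ^ 2‖ - ‖c‖ ≤ ‖quad c z‖ := by
    have := norm_sub_norm_le (z ^ 2) (-c)
    simpa [quad] using this
  rw [norm_pow] at h1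
  nlinarith

lemma norm_iterate_quad_ge {c : ℂ} (hc : ‖c‖ ≤ 1) {z : ℂ} (hz : 2 ≤ ‖z‖) (n : ℕ) :
    (3 / 2) ^ n * ‖z‖ ≤ ‖(quad c)^[n] z‖ := by
  induction n with
  | zero => simp
  | succ n ih =>
    rw [Function.iterate_succ_apply']
    have h1 : ‖z‖ ≤ (3 / 2) ^ n * ‖z‖ :=
      le_mul_of_one_le_left (norm_nonneg _) (one_le_pow₀ (by norm_num))
    have := norm_quad_ge hc (hz.trans (h1.trans ih))
    rw [pow_succ]
    linarith

lemma notMem_filledJulia_iff {c : ℂ} (hc : ‖c‖ ≤ 1) (z : ℂ) :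
    z ∉ filledJulia (quad c) ↔ ∃ n, 2 < ‖(quad c)^[n] z‖ := by
  simp only [filledJulia, mem_ofPred_eq, not_not]
  constructor
  · intro h
    exact ((tendsto_norm_atTop_iff_cobounded.2 h).eventually_gt_atTop 2).exists
  · rintro ⟨n, hn⟩
    rw [← tendsto_norm_atTop_iff_cobounded, ← tendsto_add_atTop_iff_nat n]
    have h1 : Tendsto (fun k : ℕ => (3 / 2 : ℝ) ^ k * ‖(quad c)^[n] z‖) atTop atTop :=
      (tendsto_pow_atTop_atTop_of_one_lt (by norm_num)).atTop_mul_const (by linarith)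
    refine tendsto_atTop_mono (fun k => ?_) h1
    rw [Function.iterate_add_apply]
    exact norm_iterate_quad_ge hc hn.le k

lemma isClosed_filledJulia {c : ℂ} (hc : ‖c‖ ≤ 1) : IsClosed (filledJulia (quad c)) := by
  have : (filledJulia (quad c))ᶜ = ⋃ n : ℕ, {z | 2 < ‖(quad c)^[n] z‖} := by
    ext z
    simp [← notMem_filledJulia_iff hc]
  rw [← isOpen_compl_iff, this]
  exact isOpen_iUnion fun n =>
    isOpen_lt continuous_const ((continuous_quad c).iterate n).norm

lemma filledJulia_subset {c : ℂ} (hc : ‖c‖ ≤ 1) : filledJulia (quad c) ⊆ closedBall 0 2 := by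
  intro z hz
  by_contra h
  exact (notMem_filledJulia_iff hc z).2 ⟨0, by simpa using h⟩ hz

lemma julia_subset_filledJulia {c : ℂ} (hc : ‖c‖ ≤ 1) :
    julia (quad c) ⊆ filledJulia (quad c) :=
  (isClosed_filledJulia hc).frontier_subset

/-! ### The basin of infinity as the image of the punctured disc -/

section Uniformisation

variable {c : ℂ} {g : ℂ → ℂ}

lemma IsBoettcher.ne_zero_near (h : IsBoettcher c 1 g) : ∀ᶠ s in 𝓝 (0 : ℂ), g s ≠ 0 :=
  (h.differentiableOn.differentiableAt (ball_mem_nhds 0 one_pos)).continuousAt.eventually_ne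
    (by simp [h.map_zero])

/-- The functional equation gives g(s) and g(-s) the same square, and both are 1 at 0. Evenness
settles the choice of sign when points are pulled back in `IsBoettcher.surj`. -/
lemma IsBoettcher.neg (h : IsBoettcher c 1 g) {s : ℂ} (hs : s ∈ ball (0 : ℂ) 1) :
    g (-s) = g s := by
  have hd : DifferentiableOn ℂ (fun s => g (-s)) (ball 0 1) :=
    h.differentiableOn.comp (by fun_prop) fun s hs => by simpa using hs
  obtain ⟨δ, hδ, hball⟩ := Metric.eventually_nhds_iff_ball.1
    (h.ne_zero_near.and (ball_mem_nhds (0 : ℂ) one_pos))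
  have hsub : ball (0 : ℂ) δ ⊆ ball 0 1 := fun s hs => (hball s hs).2
  have hev : EqOn (fun s => g (-s)) g (ball 0 δ) :=
    (convex_ball (0 : ℂ) δ).isPreconnected.eq_of_sq_eq (hd.continuousOn.mono hsub)
      (h.differentiableOn.continuousOn.mono hsub)
      (fun s hs => by
        have h2 := h.sq_eq (-s) (by simpa using hsub hs)
        have h3 := h.sq_eq s (hsub hs)
        simp only [Pi.pow_apply]
        rw [h2, h3, neg_sq])
      (fun hs => (hball _ hs).1) (mem_ball_self hδ) (by simp)
  exact (hd.analyticOnNhd isOpen_ball).eqOn_of_preconnected_of_eventuallyEq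
    (h.differentiableOn.analyticOnNhd isOpen_ball) (convex_ball _ _).isPreconnected
    (mem_ball_self one_pos) (hev.eventuallyEq_of_mem (ball_mem_nhds 0 hδ)) hs

/-- The reciprocal s / g(s) has derivative 1 at 0, so its image contains a neighbourhood of 0. -/
lemma IsBoettcher.exists_eq_of_large (h : IsBoettcher c 1 g) :
    ∃ M : ℝ, ∀ z : ℂ, M < ‖z‖ → ∃ s ∈ ball (0 : ℂ) 1, s ≠ 0 ∧ g s / s = z := by
  have hg : AnalyticAt ℂ g 0 := h.differentiableOn.analyticAt (ball_mem_nhds 0 one_pos)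
  have hg0 : g 0 ≠ 0 := by simp [h.map_zero]
  have hd : HasStrictDerivAt (fun s => s / g s) 1 0 := by
    have h1 := (hasStrictDerivAt_id (0 : ℂ)).div hg.hasStrictDerivAt hg0
    convert! h1 using 1
    simp [h.map_zero]
  have hm := hd.map_nhds_eq one_ne_zero
  simp only [zero_div] at hm
  have himg : (fun s => s / g s) '' (ball (0 : ℂ) 1) ∈ 𝓝 (0 : ℂ) := by
    rw [← hm]
    exact image_mem_map (ball_mem_nhds 0 one_pos)
  obtain ⟨ε, hε, hsub⟩ := Metric.mem_nhds_iff.1 himg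
  refine ⟨ε⁻¹, fun z hz => ?_⟩
  have hz0 : z ≠ 0 := norm_pos_iff.1 ((inv_pos.2 hε).trans hz)
  obtain ⟨s, hs, e⟩ := hsub (show z⁻¹ ∈ ball (0 : ℂ) ε by
    rw [mem_ball_zero_iff, norm_inv]
    exact inv_lt_of_inv_lt₀ hε hz)
  refine ⟨s, hs, ?_, ?_⟩
  · rintro rfl
    simp at e
    exact hz0 e.symm
  · rw [← inv_inj, ← e, inv_div]

/-- Some iterate of z is large enough to be a value of g(s)/s; pull back along the orbit. A square
root of the parameter gives z or -z, and -s repairs the sign. -/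
lemma IsBoettcher.surj (h : IsBoettcher c 1 g) {z : ℂ}
    (hz : z ∉ filledJulia (quad c)) : ∃ s ∈ ball (0 : ℂ) 1, s ≠ 0 ∧ g s / s = z := by
  obtain ⟨M, hM⟩ := h.exists_eq_of_large
  simp only [filledJulia, mem_ofPred_eq, not_not] at hz
  obtain ⟨n, hn⟩ := ((tendsto_norm_atTop_iff_cobounded.2 hz).eventually_gt_atTop M).exists
  replace hn := hM _ hn
  clear hz
  induction n generalizing z with
  | zero => simpa using hn
  | succ n ih =>
    rw [Function.iterate_succ_apply] at hn
    obtain ⟨t, ht, ht0, e⟩ := ih hn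
    obtain ⟨s, rfl⟩ : ∃ s : ℂ, s ^ 2 = t :=
      ⟨t ^ (2⁻¹ : ℂ), by exact_mod_cast Complex.cpow_nat_inv_pow t two_ne_zero⟩
    have hs : s ∈ ball (0 : ℂ) 1 := by
      rw [mem_ball_zero_iff, norm_pow] at ht
      rw [mem_ball_zero_iff]
      nlinarith [norm_nonneg s]
    have hs0 : s ≠ 0 := by rintro rfl; simp at ht0
    have hsq : (g s / s) ^ 2 = z ^ 2 := by
      have := h.iterate_quad le_rfl hs hs0 1
      simp only [Function.iterate_one, pow_one, e, quad] at this
      exact add_right_cancel this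
    rcases sq_eq_sq_iff_eq_or_eq_neg.1 hsq with e' | e'
    · exact ⟨s, hs, hs0, e'⟩
    · refine ⟨-s, by simpa using hs, by simpa using hs0, ?_⟩
      rw [h.neg hs, div_neg, e', neg_neg]

lemma IsBoettcher.continuousOn_div (h : IsBoettcher c 1 g) :
    ContinuousOn (fun s => g s / s) (ball 0 1 \ {0}) :=
  (h.differentiableOn.continuousOn.mono sdiff_subset).div continuousOn_id fun _ hs => hs.2

lemma IsBoettcher.notMem_filledJulia (h : IsBoettcher c 1 g) {s : ℂ} (hs : s ∈ ball (0 : ℂ) 1)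
    (h0 : s ≠ 0) : g s / s ∉ filledJulia (quad c) :=
  not_not.2 (h.tendsto_iterate one_pos le_rfl hs h0)

/-- Outside the disc of radius 2 moduli grow under iteration. A large value near the circle would
therefore give a larger one after squaring s down into a fixed compact annulus. -/
lemma IsBoettcher.exists_bound (hc : ‖c‖ ≤ 1) (h : IsBoettcher c 1 g) :
    ∃ M : ℝ, 2 ≤ M ∧ ∀ s : ℂ, 1 / 2 ≤ ‖s‖ → ‖s‖ < 1 → ‖g s / s‖ ≤ M := by
  have hA : IsCompact (closedBall (0 : ℂ) (1 / 2) \ ball 0 (1 / 4)) :=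
    (isCompact_closedBall _ _).diff isOpen_ball
  obtain ⟨M, hM⟩ := hA.exists_bound_of_continuousOn (h.continuousOn_div.mono (by
    intro s hs
    simp only [Set.mem_sdiff, mem_closedBall_zero_iff, mem_ball_zero_iff, not_lt,
      mem_singleton_iff] at hs ⊢
    exact ⟨by linarith, norm_pos_iff.1 (by linarith)⟩))
  refine ⟨max M 2, le_max_right _ _, fun s hs hs1 => ?_⟩
  by_contra! hlt
  have hs0 : s ≠ 0 := norm_pos_iff.1 (by linarith)
  have hex : ∃ n : ℕ, ‖s ^ 2 ^ n‖ ≤ 1 / 2 := by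
    have := (tendsto_pow_two_pow hs1).norm
    rw [norm_zero] at this
    exact (this.eventually (ge_mem_nhds (by norm_num : (0 : ℝ) < 1 / 2))).exists
  classical
  have hn := Nat.find_spec hex
  -- At the first time the power drops to 1/2 or below, its predecessor exceeds 1/2, so the power is
  -- at least 1/4.
  have hmin : 1 / 4 ≤ ‖s ^ 2 ^ Nat.find hex‖ := by
    rcases Nat.eq_zero_or_pos (Nat.find hex) with e | e
    · rw [e]; simp; linarith
    · have h2 := Nat.find_min hex (Nat.sub_lt e one_pos)
      obtain ⟨k, hk⟩ := Nat.exists_eq_add_of_le' e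
      rw [hk] at h2 ⊢
      simp only [Nat.succ_eq_add_one, zero_add, Nat.add_sub_cancel, not_le] at h2
      rw [pow_succ, pow_mul, norm_pow]
      nlinarith
  have h3 := hM (s ^ 2 ^ Nat.find hex) (by
    simp only [Set.mem_sdiff, mem_closedBall_zero_iff, mem_ball_zero_iff, not_lt]
    exact ⟨hn, hmin⟩)
  rw [← h.iterate_quad le_rfl (by simpa using hs1) hs0] at h3
  have h4 := norm_iterate_quad_ge hc ((le_max_right M 2).trans hlt.le) (Nat.find hex)
  have h5 : ‖g s / s‖ ≤ (3 / 2) ^ Nat.find hex * ‖g s / s‖ :=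
    le_mul_of_one_le_left (norm_nonneg _) (one_le_pow₀ (by norm_num))
  linarith [le_max_left M 2]

/-- If the limit escaped, a fixed iterate of nearby points would exceed the bound M, while the
powers s_k^(2^m) still lie near the circle, where M applies. -/
lemma IsBoettcher.mem_julia_of_tendsto (hc : ‖c‖ ≤ 1) (h : IsBoettcher c 1 g) {s : ℕ → ℂ}
    (hs : ∀ k, s k ∈ ball (0 : ℂ) 1) (h0 : ∀ k, s k ≠ 0)
    (hs1 : Tendsto (fun k => ‖s k‖) atTop (𝓝 1)) {z : ℂ}
    (hz : Tendsto (fun k => g (s k) / s k) atTop (𝓝 z)) : z ∈ julia (quad c) := by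
  obtain ⟨M, hM2, hM⟩ := h.exists_bound hc
  rw [julia, frontier_eq_closure_inter_closure]
  refine ⟨subset_closure ?_, mem_closure_of_tendsto hz
    (.of_forall fun k => h.notMem_filledJulia (hs k) (h0 k))⟩
  intro hesc
  obtain ⟨m, hm⟩ := ((tendsto_norm_atTop_iff_cobounded.2 hesc).eventually_gt_atTop M).exists
  have h1 : ∀ᶠ k in atTop, M < ‖(quad c)^[m] (g (s k) / s k)‖ :=
    ((((continuous_quad c).iterate m).norm.tendsto z).comp hz).eventually (lt_mem_nhds hm)
  have h2 : ∀ᶠ k in atTop, 1 / 2 < ‖s k‖ ^ 2 ^ m :=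
    (hs1.pow (2 ^ m)).eventually (lt_mem_nhds (by norm_num))
  obtain ⟨k, h1, h2⟩ := (h1.and h2).exists
  rw [h.iterate_quad le_rfl (hs k) (h0 k)] at h1
  have := hM (s k ^ 2 ^ m) (by rw [norm_pow]; exact h2.le)
    (by simpa using pow_two_pow_mem_ball le_rfl (hs k) m)
  linarith

lemma IsBoettcher.exists_mem_of_julia_subset (hc : ‖c‖ ≤ 1) (h : IsBoettcher c 1 g) {U : Set ℂ}
    (hU : IsOpen U) (hJ : julia (quad c) ⊆ U) :
    ∃ ρ : ℝ, ρ < 1 ∧ ∀ s : ℂ, ρ ≤ ‖s‖ → ‖s‖ < 1 → g s / s ∈ U := by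
  obtain ⟨M, hM2, hM⟩ := h.exists_bound hc
  by_contra! hcon
  have hρ : ∀ k : ℕ, (1 : ℝ) - (1 / 2) ^ (k + 1) < 1 := fun k => by
    have : (0 : ℝ) < (1 / 2) ^ (k + 1) := by positivity
    linarith
  choose s hs1 hs2 hsU using fun k => hcon _ (hρ k)
  have hhalf : ∀ k, 1 / 2 ≤ ‖s k‖ := fun k => by
    have := hs1 k
    have : ((1 : ℝ) / 2) ^ (k + 1) ≤ 1 / 2 := by
      rw [pow_succ]
      exact mul_le_of_le_one_left (by norm_num) (pow_le_one₀ (by norm_num) (by norm_num))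
    linarith
  have hlim : Tendsto (fun k => ‖s k‖) atTop (𝓝 1) := by
    refine tendsto_of_tendsto_of_tendsto_of_le_of_le ?_ tendsto_const_nhds hs1 fun k => (hs2 k).le
    have := ((tendsto_pow_atTop_nhds_zero_of_lt_one (r := (1 / 2 : ℝ)) (by norm_num)
      (by norm_num)).comp (tendsto_add_atTop_nat 1)).const_sub 1
    simpa using this
  obtain ⟨z, -, φ, hφ, hz⟩ := (isCompact_closedBall (0 : ℂ) M).tendsto_subseq
    (x := fun k => g (s k) / s k) fun k => by simpa using hM (s k) (hhalf k) (hs2 k)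
  have hzJ : z ∈ julia (quad c) := h.mem_julia_of_tendsto hc (s := s ∘ φ)
    (fun k => by simpa using hs2 (φ k)) (fun k => norm_pos_iff.1 (by
      have := hhalf (φ k); simp only [Function.comp_apply]; linarith))
    (hlim.comp hφ.tendsto_atTop) hz
  have hzU : z ∈ Uᶜ := hU.isClosed_compl.mem_of_tendsto hz (.of_forall fun k => hsU _)
  exact hzU (hJ hzJ)

end Uniformisation

end QuadLyap

namespace QuadLyap
open Metric Set

/-! ### Continuous extension to the circle by expansion -/

section Extension

variable {c : ℂ} {g : ℂ → ℂ}

lemma contDiff_iterate_quad (c : ℂ) (n : ℕ) : ContDiff ℂ 1 ((quad c)^[n]) := by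
  induction n with
  | zero => exact contDiff_id
  | succ n ih =>
    rw [Function.iterate_succ']
    exact (show ContDiff ℂ 1 (quad c) by unfold quad; fun_prop).comp ih

lemma IsHyperbolic.exists_expanding (hyp : IsHyperbolic (quad c)) :
    ∃ N : ℕ, 1 ≤ N ∧ ∀ z ∈ julia (quad c), 3 / 2 < ‖deriv ((quad c)^[N]) z‖ := by
  obtain ⟨C, hC, lam, hlam, hexp⟩ := hyp
  have ht : Tendsto (fun n : ℕ => C * lam ^ n) atTop atTop :=
    (tendsto_pow_atTop_atTop_of_one_lt hlam).const_mul_atTop hC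
  obtain ⟨N, hN, hN1⟩ := ((ht.eventually_gt_atTop (3 / 2)).and (eventually_ge_atTop 1)).exists
  exact ⟨N, hN1, fun z hz => hN.trans_le (hexp z hz N hN1)⟩

lemma IsBoettcher.hasDerivAt_div (h : IsBoettcher c 1 g) {s : ℂ} (hs : s ∈ ball (0 : ℂ) 1)
    (h0 : s ≠ 0) : HasDerivAt (fun s => g s / s) (deriv (fun s => g s / s) s) s :=
  ((h.differentiableOn.differentiableAt (isOpen_ball.mem_nhds hs)).div differentiableAt_id
    h0).hasDerivAt

/-- The chain rule for ψ(s^(2^N)) = f^N(ψ(s)), multiplied by s: the logarithmic derivative s ψ'(s)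
makes the powers of s cancel. -/
lemma IsBoettcher.deriv_iterate (h : IsBoettcher c 1 g) (N : ℕ) {s : ℂ}
    (hs : s ∈ ball (0 : ℂ) 1) (h0 : s ≠ 0) :
    (2 ^ N : ℂ) * (s ^ 2 ^ N * deriv (fun s => g s / s) (s ^ 2 ^ N)) =
      deriv ((quad c)^[N]) (g s / s) * (s * deriv (fun s => g s / s) s) := by
  have hl := (h.hasDerivAt_div (pow_two_pow_mem_ball le_rfl hs N) (pow_ne_zero _ h0)).comp
    (h := fun s => s ^ 2 ^ N) s (hasDerivAt_pow (2 ^ N) s)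
  have hr := (((contDiff_iterate_quad c N).differentiable one_ne_zero
    (g s / s)).hasDerivAt).comp (h := fun s => g s / s) s (h.hasDerivAt_div hs h0)
  have hev : ((fun s => g s / s) ∘ fun s => s ^ 2 ^ N) =ᶠ[𝓝 s]
      ((quad c)^[N] ∘ fun s => g s / s) := by
    filter_upwards [isOpen_ball.mem_nhds hs, isOpen_ne.mem_nhds h0] with t ht ht0
    exact (h.iterate_quad le_rfl ht ht0 N).symm
  have e := (hr.congr_of_eventuallyEq hev).unique hl
  rw [mul_left_comm _ s, e]
  have hp : s ^ 2 ^ N = s ^ (2 ^ N - 1) * s := by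
    rw [← pow_succ, Nat.sub_add_cancel Nat.one_le_two_pow]
  generalize deriv (fun s => g s / s) (s ^ 2 ^ N) = d
  rw [hp]
  push_cast
  ring

/-- With m = 2^N and an expansion of at least 3/2, passing from s^m back to s costs a factor m /
(3/2). Since |s|^(m^n) ≤ σ, at most n such steps lead from s into a compact annulus. -/
lemma IsBoettcher.exists_deriv_bound (hc : ‖c‖ ≤ 1) (hyp : IsHyperbolic (quad c))
    (h : IsBoettcher c 1 g) :
    ∃ (m : ℕ) (C σ : ℝ), 2 ≤ m ∧ 0 ≤ C ∧ 3 / 4 ≤ σ ∧ σ < 1 ∧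
      ∀ (n : ℕ) (s : ℂ), 1 / 2 ≤ ‖s‖ → ‖s‖ < 1 → ‖s‖ ^ m ^ n ≤ σ →
        ‖s * deriv (fun s => g s / s) s‖ ≤ C * (m / (3 / 2)) ^ n := by
  obtain ⟨N, hN1, hN⟩ := hyp.exists_expanding
  have hcont : Continuous fun z => ‖deriv ((quad c)^[N]) z‖ :=
    ((contDiff_iterate_quad c N).continuous_deriv le_rfl).norm
  obtain ⟨ρ, hρ1, hρ⟩ := h.exists_mem_of_julia_subset hc
    (isOpen_lt (continuous_const (y := (3 / 2 : ℝ))) hcont) hN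
  set m : ℕ := 2 ^ N with hm
  have hm2 : 2 ≤ m := by
    calc 2 = 2 ^ 1 := rfl
      _ ≤ 2 ^ N := Nat.pow_le_pow_right (by norm_num) hN1
  have hm2' : (2 : ℝ) ≤ m := by exact_mod_cast hm2
  set σ : ℝ := max ρ (3 / 4)
  have hσ1 : σ < 1 := max_lt hρ1 (by norm_num)
  have hσ34 : 3 / 4 ≤ σ := le_max_right _ _
  have hσ0 : 0 < σ := by linarith
  set l : ℝ := min (1 / 2) (σ ^ m)
  have hl0 : 0 < l := lt_min (by norm_num) (by positivity)
  have hA : IsCompact (closedBall (0 : ℂ) σ \ ball 0 l) :=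
    (isCompact_closedBall _ _).diff isOpen_ball
  have hd : ContinuousOn (fun s => s * deriv (fun s => g s / s) s) (ball 0 1 \ {0}) := by
    have hopen : IsOpen (ball (0 : ℂ) 1 \ {0}) := isOpen_ball.sdiff isClosed_singleton
    have hdiff : DifferentiableOn ℂ (fun s => g s / s) (ball 0 1 \ {0}) := fun s hs =>
      (h.hasDerivAt_div hs.1 hs.2).differentiableAt.differentiableWithinAt
    exact continuousOn_id.mul (hdiff.deriv hopen).continuousOn
  obtain ⟨C, hC⟩ := hA.exists_bound_of_continuousOn (hd.mono (by
    intro s hs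
    simp only [Set.mem_sdiff, mem_closedBall_zero_iff, mem_ball_zero_iff, not_lt,
      mem_singleton_iff] at hs ⊢
    exact ⟨by linarith, norm_pos_iff.1 (by linarith)⟩))
  have hC0 : 0 ≤ max C 0 := le_max_right _ _
  have hsmall : ∀ s : ℂ, l ≤ ‖s‖ → ‖s‖ ≤ σ →
      ‖s * deriv (fun s => g s / s) s‖ ≤ max C 0 := fun s h1 h2 =>
    (hC s (by simpa using ⟨h2, h1⟩)).trans (le_max_left _ _)
  refine ⟨m, max C 0, σ, hm2, hC0, hσ34, hσ1, ?_⟩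
  suffices H : ∀ (n : ℕ) (s : ℂ), l ≤ ‖s‖ → ‖s‖ < 1 → ‖s‖ ^ m ^ n ≤ σ →
      ‖s * deriv (fun s => g s / s) s‖ ≤ max C 0 * (m / (3 / 2)) ^ n from
    fun n s h1 => H n s ((min_le_left _ _).trans h1)
  intro n
  induction n with
  | zero =>
    intro s h1 _ h2
    simpa using hsmall s h1 (by simpa using h2)
  | succ n ih =>
    intro s h1 h2 h3
    rcases le_or_gt ‖s‖ σ with h4 | h4
    · refine (hsmall s h1 h4).trans (le_mul_of_one_le_right hC0 (one_le_pow₀ ?_))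
      rw [le_div_iff₀ (by norm_num)]
      linarith
    · have hs0 : s ≠ 0 := norm_pos_iff.1 (by linarith)
      have hexp : 3 / 2 < ‖deriv ((quad c)^[N]) (g s / s)‖ :=
        hρ s ((le_max_left _ _).trans h4.le) h2
      have hK := h.deriv_iterate N (s := s) (by simpa using h2) hs0
      have i := ih (s ^ m) (by
          rw [norm_pow]
          exact (min_le_right _ _).trans (by gcongr))
        (by rw [norm_pow]; exact pow_lt_one₀ (norm_nonneg _) h2 (by lia))
        (by rwa [norm_pow, ← pow_mul, ← pow_succ'])
      rw [← hm] at hK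
      have hK' := congrArg norm hK
      rw [norm_mul, norm_mul (deriv ((quad c)^[N]) (g s / s))] at hK'
      have e2 : ‖(2 ^ N : ℂ)‖ = (m : ℝ) := by rw [hm]; simp
      rw [e2] at hK'
      have h5 : 3 / 2 * ‖s * deriv (fun s => g s / s) s‖ ≤
          m * (max C 0 * (m / (3 / 2)) ^ n) := by
        calc _ ≤ ‖deriv ((quad c)^[N]) (g s / s)‖ * ‖s * deriv (fun s => g s / s) s‖ := by
              gcongr
          _ = _ := hK'.symm
          _ ≤ _ := by gcongr
      rw [pow_succ]
      calc _ = (3 / 2 * ‖s * deriv (fun s => g s / s) s‖) / (3 / 2) := by ring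
        _ ≤ (m * (max C 0 * (m / (3 / 2)) ^ n)) / (3 / 2) := by gcongr
        _ = _ := by ring

lemma IsBoettcher.norm_div_sub_le (h : IsBoettcher c 1 g) {B a b : ℝ} {s : ℂ}
    (ha : 1 / 2 ≤ a * ‖s‖) (hab : a ≤ b) (ha0 : 0 < a) (hb : b * ‖s‖ < 1)
    (hB : ∀ ρ ∈ Icc a b, ‖(ρ * s) * deriv (fun s => g s / s) (ρ * s)‖ ≤ B) (hs : ‖s‖ ≤ 1) :
    ‖g (b * s) / (b * s) - g (a * s) / (a * s)‖ ≤ 2 * B * (b - a) := by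
  have hρs : ∀ ρ ∈ Icc a b, 1 / 2 ≤ ‖(ρ : ℂ) * s‖ ∧ ‖(ρ : ℂ) * s‖ < 1 := fun ρ hρ => by
    have hρ0 : 0 ≤ ρ := ha0.le.trans hρ.1
    rw [norm_mul, Complex.norm_real, Real.norm_of_nonneg hρ0]
    constructor
    · exact ha.trans (by gcongr; exact hρ.1)
    · exact lt_of_le_of_lt (by gcongr; exact hρ.2) hb
  have hder : ∀ ρ ∈ Icc a b, HasDerivWithinAt
      (fun ρ : ℝ => g (ρ * s) / (ρ * s)) (s * deriv (fun s => g s / s) (ρ * s))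
      (Icc a b) ρ := fun ρ hρ => by
    have h1 := h.hasDerivAt_div (s := ρ * s) (by simpa using (hρs ρ hρ).2)
      (norm_pos_iff.1 (by have := (hρs ρ hρ).1; linarith))
    have h2 : HasDerivAt (fun ρ : ℝ => (ρ : ℂ) * s) s ρ := by
      simpa using (Complex.ofRealCLM.hasDerivAt (x := ρ)).mul_const s
    have h3 := (h1.scomp ρ h2).hasDerivWithinAt (s := Icc a b)
    simpa [smul_eq_mul, Function.comp_def] using h3
  refine norm_image_sub_le_of_norm_deriv_le_segment' hder (fun ρ hρ => ?_) b
    (right_mem_Icc.2 hab)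
  have h1 := hB ρ (Ico_subset_Icc_self hρ)
  have h2 := (hρs ρ (Ico_subset_Icc_self hρ)).1
  have hρ0 : 0 ≤ ρ := ha0.le.trans hρ.1
  rw [norm_mul] at h1 ⊢
  nlinarith [norm_nonneg (deriv (fun s => g s / s) (ρ * s))]

/-- With ρ_n = σ^(1/m^n), the step from ρ_n s to ρ_(n+1) s has length of order m^(-n), while the
derivative is of order (m / (3/2))^n. The increments are of order (2/3)^n, uniformly on the annulus
3/4 ≤ |s| ≤ 1. -/
lemma IsBoettcher.exists_extension (hc : ‖c‖ ≤ 1) (hyp : IsHyperbolic (quad c))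
    (h : IsBoettcher c 1 g) :
    ∃ H : ℂ → ℂ, ContinuousOn H (closedBall 0 1 \ {0}) ∧
      ∀ s ∈ ball (0 : ℂ) 1, H s = g s / s := by
  obtain ⟨m, C, σ, hm2, hC0, hσ34, hσ1, hbd⟩ := h.exists_deriv_bound hc hyp
  have hm2' : (2 : ℝ) ≤ m := by exact_mod_cast hm2
  have hσ0 : 0 < σ := by linarith
  set x : ℝ := -Real.log σ
  have hx : 0 < x := by simp only [x]; linarith [Real.log_neg hσ0 hσ1]
  set ρ : ℕ → ℝ := fun n => Real.exp (-(x / m ^ n))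
  have hρ0 : ∀ n, 0 < ρ n := fun n => Real.exp_pos _
  have hρ1 : ∀ n, ρ n < 1 := fun n => by
    simp only [ρ, Real.exp_lt_one_iff]
    have : 0 < x / m ^ n := by positivity
    linarith
  have hρmono : ∀ n, ρ n ≤ ρ (n + 1) := fun n => by
    simp only [ρ, Real.exp_le_exp, neg_le_neg_iff]
    gcongr
    · linarith
    · lia
  have hρσ : ∀ n, σ ≤ ρ n := fun n => by
    have : σ = Real.exp (-x) := by simp [x, Real.exp_log hσ0]
    rw [this]
    simp only [ρ, Real.exp_le_exp, neg_le_neg_iff]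
    exact div_le_self hx.le (one_le_pow₀ (by linarith))
  have hρpow : ∀ n, ρ n ^ m ^ n = σ := fun n => by
    simp only [ρ, ← Real.exp_nat_mul]
    have : ((m ^ n : ℕ) : ℝ) * -(x / m ^ n) = Real.log σ := by
      push_cast
      have : (m : ℝ) ^ n ≠ 0 := by positivity
      field_simp
      simp [x]
    rw [this, Real.exp_log hσ0]
  have hρx : ∀ n, 1 - ρ n ≤ x / m ^ n := fun n => by
    have := Real.add_one_le_exp (-(x / m ^ n))
    simp only [ρ]
    linarith
  have hρlim : Tendsto ρ atTop (𝓝 1) := by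
    have h1 : Tendsto (fun n : ℕ => -(x / m ^ n)) atTop (𝓝 0) := by
      have := (tendsto_const_nhds (x := x)).div_atTop
        (tendsto_pow_atTop_atTop_of_one_lt (r := (m : ℝ)) (by linarith))
      simpa using this.neg
    simpa [ρ, Function.comp_def] using (Real.continuous_exp.tendsto 0).comp h1
  set A : Set ℂ := {s | 3 / 4 ≤ ‖s‖ ∧ ‖s‖ ≤ 1}
  set F : ℕ → ℂ → ℂ := fun n s => g (ρ n * s) / (ρ n * s)
  have hmem : ∀ n, ∀ s ∈ A, (ρ n : ℂ) * s ∈ ball (0 : ℂ) 1 \ {0} := by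
    intro n s hs
    have hn : ‖(ρ n : ℂ) * s‖ = ρ n * ‖s‖ := by
      rw [norm_mul, Complex.norm_real, Real.norm_of_nonneg (hρ0 n).le]
    refine ⟨?_, ?_⟩
    · rw [mem_ball_zero_iff, hn]
      nlinarith [hρ0 n, hρ1 n, hs.2, hs.1]
    · have : 0 < ‖(ρ n : ℂ) * s‖ := by
        rw [hn]
        exact mul_pos (hρ0 n) (by linarith [hs.1])
      exact norm_pos_iff.1 this
  have hFc : ∀ n, ContinuousOn (F n) A := fun n =>
    h.continuousOn_div.comp (by fun_prop) (hmem n)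
  set u : ℕ → ℝ := fun n => 2 * C * (m / (3 / 2)) * x * (2 / 3) ^ n
  have hu : Summable u :=
    (summable_geometric_of_lt_one (by norm_num) (by norm_num)).mul_left _
  have hstep : ∀ n, ∀ s ∈ A, ‖F (n + 1) s - F n s‖ ≤ u n := by
    intro n s hs
    have hb1 : ρ (n + 1) * ‖s‖ < 1 := by nlinarith [hρ0 (n + 1), hρ1 (n + 1), hs.2]
    have ha1 : 1 / 2 ≤ ρ n * ‖s‖ := by nlinarith [hρσ n, hs.1]
    have h1 := h.norm_div_sub_le (B := C * (m / (3 / 2)) ^ (n + 1)) ha1 (hρmono n) (hρ0 n) hb1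
      (fun r hr => by
        have hr0 : 0 ≤ r := (hρ0 n).le.trans hr.1
        have hn : ‖(r : ℂ) * s‖ = r * ‖s‖ := by
          rw [norm_mul, Complex.norm_real, Real.norm_of_nonneg hr0]
        refine hbd (n + 1) _ ?_ ?_ ?_
        · rw [hn]; exact ha1.trans (by gcongr; exact hr.1)
        · rw [hn]; exact lt_of_le_of_lt (by gcongr; exact hr.2) hb1
        · rw [hn, ← hρpow (n + 1)]
          gcongr
          calc r * ‖s‖ ≤ ρ (n + 1) * 1 := by gcongr; exacts [hr.2, hs.2]
            _ = _ := mul_one _) hs.2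
    refine h1.trans ?_
    have h2 : ρ (n + 1) - ρ n ≤ x / m ^ n := by linarith [hρx n, hρ1 (n + 1)]
    calc _ ≤ 2 * (C * (m / (3 / 2)) ^ (n + 1)) * (x / m ^ n) := by gcongr
      _ = u n := by
        have : (m : ℝ) ^ n ≠ 0 := by positivity
        simp only [u, div_pow, pow_succ]
        field_simp
  set T : ℂ → ℂ := fun s => F 0 s + ∑' n, (F (n + 1) s - F n s)
  have hTc : ContinuousOn T A :=
    (hFc 0).add (continuousOn_tsum (fun n => (hFc (n + 1)).sub (hFc n)) hu hstep)
  have hTlim : ∀ s ∈ A, Tendsto (fun n => F n s) atTop (𝓝 (T s)) := by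
    intro s hs
    have h1 : Summable fun n => F (n + 1) s - F n s :=
      Summable.of_norm_bounded hu fun n => hstep n s hs
    refine (h1.hasSum.tendsto_sum_nat.const_add (F 0 s)).congr fun n => ?_
    rw [Finset.sum_range_sub (fun n => F n s)]
    ring
  have hTeq : ∀ s ∈ A, ‖s‖ < 1 → T s = g s / s := by
    intro s hs hs1
    refine tendsto_nhds_unique (hTlim s hs) ?_
    have hs0 : s ≠ 0 := norm_pos_iff.1 (by linarith [hs.1])
    have hca : ContinuousAt (fun s => g s / s) s :=
      (h.hasDerivAt_div (by simpa using hs1) hs0).continuousAt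
    refine hca.tendsto.comp ?_
    have := ((Complex.continuous_ofReal.tendsto 1).comp hρlim).mul_const s
    simpa using this
  classical
  refine ⟨fun s => if ‖s‖ < 1 then g s / s else T s, ?_, fun s hs => if_pos (by simpa using hs)⟩
  intro s hs
  rcases lt_or_ge ‖s‖ 1 with h1 | h1
  · have hca := (h.hasDerivAt_div (by simpa using h1) hs.2).continuousAt
    refine (hca.congr ?_).continuousWithinAt
    filter_upwards [isOpen_ball.mem_nhds (show s ∈ ball (0 : ℂ) 1 by simpa using h1)] with t ht
    rw [if_pos (by simpa using ht)]
  · have hs1 : ‖s‖ = 1 := le_antisymm (by simpa using hs.1) h1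
    have hsA : s ∈ A := ⟨by rw [hs1]; norm_num, hs1.le⟩
    have hA : ContinuousWithinAt (fun s => if ‖s‖ < 1 then g s / s else T s) A s := by
      refine (hTc s hsA).congr (fun t ht => ?_) (by simp [hs1])
      split_ifs with h2
      · exact (hTeq t ht h2).symm
      · rfl
    refine hA.mono_of_mem_nhdsWithin ?_
    have : {t : ℂ | 3 / 4 < ‖t‖} ∈ 𝓝 s :=
      (isOpen_lt continuous_const continuous_norm).mem_nhds
        (by simp only [mem_ofPred_eq, hs1]; norm_num)
    filter_upwards [mem_nhdsWithin_of_mem_nhds this, self_mem_nhdsWithin] with t h2 h3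
    exact ⟨le_of_lt h2, by simpa using h3.1⟩

end Extension

end QuadLyap

namespace QuadLyap
open Metric Set

/-! ### Existence and uniqueness of the circle parametrisation -/

section Conjugacy

variable {c : ℂ} {g H : ℂ → ℂ}

lemma closedBall_diff_subset_closure :
    closedBall (0 : ℂ) 1 \ {0} ⊆ closure (ball (0 : ℂ) 1 \ {0}) := by
  have h := (isOpen_compl_singleton (x := (0 : ℂ))).inter_closure (t := ball (0 : ℂ) 1)
  rw [closure_ball _ one_ne_zero, inter_comm, inter_comm {0}ᶜ] at h
  exact h

lemma IsBoettcher.extension_sq (h : IsBoettcher c 1 g)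
    (hHc : ContinuousOn H (closedBall 0 1 \ {0})) (hH : ∀ s ∈ ball (0 : ℂ) 1, H s = g s / s) :
    EqOn (fun s => H (s ^ 2)) (fun s => quad c (H s)) (closedBall 0 1 \ {0}) := by
  refine EqOn.of_subset_closure (s := ball (0 : ℂ) 1 \ {0}) ?_ ?_ ?_
    (sdiff_subset_sdiff_left ball_subset_closedBall) closedBall_diff_subset_closure
  · intro s hs
    have h1 := h.iterate_quad le_rfl hs.1 hs.2 1
    simp only [Function.iterate_one, pow_one] at h1
    simp only
    rw [hH s hs.1, hH _ (sq_mem_ball le_rfl hs.1), h1]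
  · refine hHc.comp (by fun_prop) fun s hs => ⟨?_, pow_ne_zero _ hs.2⟩
    have := mem_closedBall_zero_iff.1 hs.1
    rw [mem_closedBall_zero_iff, norm_pow]
    exact pow_le_one₀ (norm_nonneg _) this
  · exact (continuous_quad c).comp_continuousOn hHc

/-- A Julia point is a limit of basin points ψ(s_k). A limit t of the s_k is nonzero, as s_k ψ(s_k)
= g(s_k) would tend to 1 rather than 0, and is not inside the disc, as the Julia point would then
escape. -/
lemma IsBoettcher.range_extension (hc : ‖c‖ ≤ 1) (h : IsBoettcher c 1 g)
    (hHc : ContinuousOn H (closedBall 0 1 \ {0})) (hH : ∀ s ∈ ball (0 : ℂ) 1, H s = g s / s) :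
    H '' sphere 0 1 = julia (quad c) := by
  have hsph : ∀ s ∈ sphere (0 : ℂ) 1, s ∈ closedBall (0 : ℂ) 1 \ {0} := fun s hs =>
    ⟨sphere_subset_closedBall hs, ne_of_mem_sphere hs one_ne_zero⟩
  refine Subset.antisymm ?_ ?_
  · rintro _ ⟨s, hs, rfl⟩
    obtain ⟨t, ht, htl⟩ := mem_closure_iff_seq_limit.1 (closedBall_diff_subset_closure (hsph s hs))
    refine h.mem_julia_of_tendsto hc (fun k => (ht k).1) (fun k => (ht k).2) ?_ (z := H s) ?_
    · simpa [mem_sphere_zero_iff_norm.1 hs] using htl.norm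
    · have h1 := (hHc s (hsph s hs)).tendsto.comp (tendsto_nhdsWithin_iff.2
        ⟨htl, .of_forall fun k => sdiff_subset_sdiff_left ball_subset_closedBall (ht k)⟩)
      exact h1.congr fun k => hH _ (ht k).1
  · intro z hz
    have hz' := hz
    rw [julia, frontier_eq_closure_inter_closure] at hz'
    obtain ⟨x, hx, hxl⟩ := mem_closure_iff_seq_limit.1 hz'.2
    choose s hs hs0 hsx using fun k => h.surj (hx k)
    obtain ⟨t, ht, φ, hφ, htl⟩ := (isCompact_closedBall (0 : ℂ) 1).tendsto_subseq
      fun k => ball_subset_closedBall (hs k)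
    have hxl' := hxl.comp hφ.tendsto_atTop
    have ht0 : t ≠ 0 := by
      rintro rfl
      have h1 : Tendsto (fun k => s (φ k) * x (φ k)) atTop (𝓝 (0 * z)) := htl.mul hxl'
      have hg : ContinuousAt g 0 :=
        (h.differentiableOn.differentiableAt (ball_mem_nhds 0 one_pos)).continuousAt
      have h2 : Tendsto (fun k => g (s (φ k))) atTop (𝓝 1) := by
        simpa [h.map_zero, Function.comp_def] using hg.tendsto.comp htl
      have h3 : (fun k => s (φ k) * x (φ k)) = fun k => g (s (φ k)) := by
        ext k
        rw [← hsx, mul_div_cancel₀ _ (hs0 _)]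
      rw [h3] at h1
      simpa using tendsto_nhds_unique h1 h2
    have hlim : Tendsto (fun k => x (φ k)) atTop (𝓝 (H t)) := by
      have h1 := (hHc t ⟨ht, ht0⟩).tendsto.comp (tendsto_nhdsWithin_iff.2
        ⟨htl, .of_forall fun k => ⟨ball_subset_closedBall (hs _), hs0 _⟩⟩)
      refine h1.congr fun k => ?_
      simp only [Function.comp_apply]
      rw [hH _ (hs _), hsx]
    have hzt : H t = z := tendsto_nhds_unique hlim hxl'
    refine ⟨t, ?_, hzt⟩
    rw [mem_sphere_zero_iff_norm]
    refine le_antisymm (by simpa using ht) (not_lt.1 fun hlt => ?_)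
    have htb : t ∈ ball (0 : ℂ) 1 := by simpa using hlt
    rw [hH t htb] at hzt
    exact h.notMem_filledJulia htb ht0 (hzt ▸ julia_subset_filledJulia hc hz)

lemma inv_mem_closedBall_diff {w : ℂ} (hw : 1 ≤ ‖w‖) : w⁻¹ ∈ closedBall (0 : ℂ) 1 \ {0} := by
  have h0 : w ≠ 0 := norm_pos_iff.1 (by linarith)
  refine ⟨?_, inv_ne_zero h0⟩
  rw [mem_closedBall_zero_iff, norm_inv]
  exact inv_le_one_of_one_le₀ hw

lemma inv_mem_ball_diff {w : ℂ} (hw : 1 < ‖w‖) : w⁻¹ ∈ ball (0 : ℂ) 1 \ {0} := by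
  have h0 : w ≠ 0 := norm_pos_iff.1 (by linarith)
  refine ⟨?_, inv_ne_zero h0⟩
  rw [mem_ball_zero_iff, norm_inv]
  exact inv_lt_one_of_one_lt₀ hw

lemma IsBoettcher.isCircleConjugacy (hc : ‖c‖ ≤ 1) (h : IsBoettcher c 1 g)
    (hHc : ContinuousOn H (closedBall 0 1 \ {0})) (hH : ∀ s ∈ ball (0 : ℂ) 1, H s = g s / s) :
    IsCircleConjugacy 2 (quad c) fun z => H (z : ℂ)⁻¹ := by
  have hinv : ContinuousOn (fun w : ℂ => w⁻¹) {w | 1 ≤ ‖w‖} :=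
    continuousOn_inv₀.mono fun w hw => norm_pos_iff.1 (one_pos.trans_le hw)
  have hΨc : ContinuousOn (fun w : ℂ => H w⁻¹) {w | 1 ≤ ‖w‖} :=
    hHc.comp hinv fun w hw => inv_mem_closedBall_diff hw
  have hΨs : ∀ w : ℂ, 1 ≤ ‖w‖ → H (w ^ 2)⁻¹ = quad c (H w⁻¹) := fun w hw => by
    rw [← inv_pow]
    exact h.extension_sq hHc hH (inv_mem_closedBall_diff hw)
  refine ⟨?_, ?_, ?_, fun w => H w⁻¹, hΨc, ?_, hΨs, ?_, fun z => rfl⟩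
  · exact hΨc.comp_continuous (by fun_prop) fun z => (Circle.norm_coe z).ge
  · rw [← h.range_extension hc hHc hH]
    ext z
    constructor
    · rintro ⟨w, rfl⟩
      exact ⟨(w : ℂ)⁻¹, by rw [mem_sphere_zero_iff_norm, norm_inv, Circle.norm_coe, inv_one], rfl⟩
    · rintro ⟨s, hs, rfl⟩
      exact ⟨(⟨s, hs⟩ : Circle)⁻¹, congrArg H (inv_inv s)⟩
  · intro z
    simp only [Circle.coe_pow]
    exact hΨs z (Circle.norm_coe z).ge
  · have hd : DifferentiableOn ℂ (fun w : ℂ => g w⁻¹ / w⁻¹) {w | 1 < ‖w‖} := fun w hw =>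
      ((h.hasDerivAt_div (inv_mem_ball_diff hw).1 (inv_mem_ball_diff hw).2).comp w
        (hasDerivAt_inv (norm_pos_iff.1 (one_pos.trans hw)))).differentiableAt.differentiableWithinAt
    exact hd.congr fun w hw => hH _ (inv_mem_ball_diff hw).1
  · have hg : ContinuousAt g 0 :=
      (h.differentiableOn.differentiableAt (ball_mem_nhds 0 one_pos)).continuousAt
    have h1 : Tendsto (fun w : ℂ => g w⁻¹) (Bornology.cobounded ℂ) (𝓝 1) := by
      simpa [h.map_zero, Function.comp_def] using hg.tendsto.comp tendsto_inv₀_cobounded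
    refine h1.congr' ?_
    filter_upwards [tendsto_norm_cobounded_atTop.eventually_gt_atTop 1] with w hw
    have h0 : w ≠ 0 := norm_pos_iff.1 (one_pos.trans hw)
    rw [hH _ (inv_mem_ball_diff hw).1]
    field_simp

/-- The function s Ψ(1/s) has a removable singularity at 0, where the normalisation at infinity
gives the value 1. This reduces uniqueness of Φ to that of g. -/
lemma IsCircleConjugacy.exists_isBoettcher {Φ : Circle → ℂ} (hΦ : IsCircleConjugacy 2 (quad c) Φ) :
    ∃ (g Ψ : ℂ → ℂ), IsBoettcher c 1 g ∧ ContinuousOn Ψ {w | 1 ≤ ‖w‖} ∧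
      (∀ w : ℂ, 1 < ‖w‖ → Ψ w = w * g w⁻¹) ∧ ∀ z : Circle, Ψ z = Φ z := by
  obtain ⟨Ψ, hΨc, hΨd, hΨs, hΨn, hΨΦ⟩ := hΦ.normalised
  set g : ℂ → ℂ := fun s => if s = 0 then 1 else s * Ψ s⁻¹
  have hg : ∀ s, s ≠ 0 → g s = s * Ψ s⁻¹ := fun s hs => if_neg hs
  have hg0 : g 0 = 1 := if_pos rfl
  have hlt : ∀ s ∈ ball (0 : ℂ) 1, s ≠ 0 → 1 < ‖s⁻¹‖ := fun s hs h0 => by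
    rw [norm_inv]
    exact (one_lt_inv₀ (norm_pos_iff.2 h0)).2 (mem_ball_zero_iff.1 hs)
  refine ⟨g, Ψ, ⟨?_, hg0, ?_⟩, hΨc, ?_, hΨΦ⟩
  · refine (Complex.differentiableOn_compl_singleton_and_continuousAt_iff
      (ball_mem_nhds 0 one_pos)).1 ⟨?_, ?_⟩
    · have hd : DifferentiableOn ℂ (fun s => s * Ψ s⁻¹) (ball 0 1 \ {0}) := by
        refine differentiableOn_id.mul (hΨd.comp ?_ fun s hs => hlt s hs.1 hs.2)
        exact differentiableOn_inv.mono fun s hs => hs.2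
      exact hd.congr fun s hs => hg s hs.2
    · rw [continuousAt_iff_punctured_nhds, hg0]
      refine (hΨn.comp tendsto_inv₀_nhdsNE_zero).congr' ?_
      filter_upwards [self_mem_nhdsWithin] with s hs
      rw [hg s hs]
      simp [mul_comm]
  · intro s hs
    rcases eq_or_ne s 0 with rfl | h0
    · simp [hg0]
    · rw [hg s h0, hg _ (pow_ne_zero 2 h0), ← inv_pow, hΨs _ (hlt s hs h0).le, quad]
      ring
  · intro w hw
    have h0 : w ≠ 0 := norm_pos_iff.1 (one_pos.trans hw)
    rw [hg _ (inv_ne_zero h0), inv_inv, mul_inv_cancel_left₀ h0]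

lemma IsCircleConjugacy.unique {Φ₁ Φ₂ : Circle → ℂ} (h₁ : IsCircleConjugacy 2 (quad c) Φ₁)
    (h₂ : IsCircleConjugacy 2 (quad c) Φ₂) : Φ₁ = Φ₂ := by
  obtain ⟨g₁, Ψ₁, hg₁, hc₁, he₁, hΦ₁⟩ := h₁.exists_isBoettcher
  obtain ⟨g₂, Ψ₂, hg₂, hc₂, he₂, hΦ₂⟩ := h₂.exists_isBoettcher
  have hcl : {w : ℂ | 1 ≤ ‖w‖} ⊆ closure {w : ℂ | 1 < ‖w‖} := by
    intro w hw
    have ht : Tendsto (fun n : ℕ => ((1 + 1 / ((n : ℝ) + 1) : ℝ) : ℂ) * w) atTop (𝓝 w) := by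
      have h1 := (tendsto_one_div_add_atTop_nhds_zero_nat (𝕜 := ℝ)).const_add 1
      have h2 := ((Complex.continuous_ofReal.tendsto _).comp h1).mul_const w
      simpa [Function.comp_def] using h2
    refine mem_closure_of_tendsto ht (.of_forall fun n => ?_)
    have hn : (0 : ℝ) < 1 / ((n : ℝ) + 1) := by positivity
    simp only [mem_ofPred_eq] at hw ⊢
    rw [norm_mul, Complex.norm_real, Real.norm_of_nonneg (by positivity)]
    nlinarith
  have heq : EqOn Ψ₁ Ψ₂ {w : ℂ | 1 ≤ ‖w‖} := by
    refine EqOn.of_subset_closure (s := {w : ℂ | 1 < ‖w‖}) ?_ hc₁ hc₂ (fun w (hw : 1 < ‖w‖) => hw.le) hcl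
    intro w hw
    rw [he₁ w hw, he₂ w hw, hg₁.eqOn one_pos hg₂ (inv_mem_ball_diff hw).1]
  ext z
  rw [← hΦ₁, ← hΦ₂, heq (Circle.norm_coe z).ge]

lemma HasBoundedCriticalOrbit.not_tendsto (hcrit : HasBoundedCriticalOrbit (quad c)) :
    ¬ Tendsto (fun n => (quad c)^[n] c) atTop (Bornology.cobounded ℂ) := by
  intro ht
  have hb := hcrit 0 (by unfold quad; simp)
  obtain ⟨M, hM⟩ := hb.exists_norm_le
  obtain ⟨n, hn⟩ := ((tendsto_norm_atTop_iff_cobounded.2 ht).eventually_gt_atTop M).exists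
  have h1 := hM _ ⟨n + 1, rfl⟩
  simp only [Function.iterate_succ_apply] at h1
  have h2 : quad c 0 = c := by simp [quad]
  rw [h2] at h1
  linarith

theorem exists_isCircleConjugacy (hc : ‖c‖ ≤ 1) (hyp : IsHyperbolic (quad c))
    (hcrit : HasBoundedCriticalOrbit (quad c)) : ∃ Φ, IsCircleConjugacy 2 (quad c) Φ := by
  obtain ⟨g, hg⟩ := exists_isBoettcher hc hcrit.not_tendsto
  obtain ⟨H, hHc, hH⟩ := hg.exists_extension hc hyp
  exact ⟨_, hg.isCircleConjugacy hc hHc hH⟩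

end Conjugacy

end QuadLyap

namespace QuadLyap
open Set

/-! ### Weighted preimages under doubling and random binary digits -/

section DigitMeasure

/-- The letter applied last is the leading binary digit, so words are read off a digit sequence in
reverse; prefixes of one sequence then give convergent points. -/
lemma wordBranch_rev_succ (n : ℕ) (ω : ℕ → Fin 2) (t : ℝ) :
    wordBranch 2 (n + 1) (fun i => ω (i.rev : ℕ)) t =
      branch 2 (ω 0) (wordBranch 2 n (fun i => ω (i.rev + 1 : ℕ)) t) := by
  simp only [wordBranch, Fin.rev_last, Fin.rev_castSucc, Fin.val_zero, Fin.val_succ]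

lemma ofDigits_eq_branch (ω : ℕ → Fin 2) :
    Real.ofDigits ω = branch 2 (ω 0) (Real.ofDigits fun i => ω (i + 1)) := by
  rw [Real.ofDigits_eq_sum_add_ofDigits ω 1]
  simp [Real.ofDigitsTerm, branch]
  ring

lemma abs_wordBranch_sub_ofDigits_le {t : ℝ} (ht : t ∈ Icc (0 : ℝ) 1) (n : ℕ) (ω : ℕ → Fin 2) :
    |wordBranch 2 n (fun i => ω (i.rev : ℕ)) t - Real.ofDigits ω| ≤ (1 / 2) ^ n := by
  induction n generalizing ω with
  | zero =>
    have h1 := Real.ofDigits_nonneg ω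
    have h2 := Real.ofDigits_le_one ω
    simp only [wordBranch, pow_zero]
    rw [abs_le]
    constructor <;> linarith [ht.1, ht.2]
  | succ n ih =>
    rw [wordBranch_rev_succ, ofDigits_eq_branch]
    have h := ih fun i => ω (i + 1)
    have e : ∀ x y : ℝ, branch 2 (ω 0) x - branch 2 (ω 0) y = (x - y) * (1 / 2) := fun x y => by
      simp only [branch]; push_cast; ring
    rw [e, abs_mul, pow_succ, abs_of_pos (by norm_num : (0 : ℝ) < 1 / 2)]
    gcongr

lemma wordBranch_mem_Icc {t : ℝ} (ht : t ∈ Icc (0 : ℝ) 1) (n : ℕ) (η : Fin n → Fin 2) :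
    wordBranch 2 n η t ∈ Icc (0 : ℝ) 1 := by
  induction n with
  | zero => exact ht
  | succ n ih =>
    have h := ih fun i => η i.castSucc
    simp only [wordBranch, branch]
    have h1 : ((η (Fin.last n) : ℕ) : ℝ) ≤ 1 := by
      exact_mod_cast Nat.lt_succ_iff.1 (η (Fin.last n)).2
    have h0 : (0 : ℝ) ≤ ((η (Fin.last n) : ℕ) : ℝ) := Nat.cast_nonneg _
    push_cast
    constructor <;> linarith [h.1, h.2]

/-- The probability measure on the letters with weights `p`. -/
noncomputable def letterMeasure (p : Fin 2 → ℝ) : Measure (Fin 2) :=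
  ∑ j, ENNReal.ofReal (p j) • Measure.dirac j

lemma letterMeasure_singleton (p : Fin 2 → ℝ) (j : Fin 2) :
    letterMeasure p {j} = ENNReal.ofReal (p j) := by
  fin_cases j <;> simp [letterMeasure]

lemma IsPosProbVec.isProbabilityMeasure {p : Fin 2 → ℝ} (hp : IsPosProbVec p) :
    IsProbabilityMeasure (letterMeasure p) := by
  constructor
  have : ENNReal.ofReal (p 0) + ENNReal.ofReal (p 1) = 1 := by
    rw [← ENNReal.ofReal_add (hp.1 0).le (hp.1 1).le, ← Fin.sum_univ_two, hp.2, ENNReal.ofReal_one]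
  simpa [letterMeasure] using this

/-- The average of `h` over the `n`-th order preimages of `t` under doubling, with weights `p`. -/
noncomputable def wordAverage (p : Fin 2 → ℝ) (n : ℕ) (h : ℝ → ℝ) (t : ℝ) : ℝ :=
  ∑ η : Fin n → Fin 2, (∏ i, p (η i)) * h (wordBranch 2 n η t)

/-- The event is a cylinder on the first n digits, and reversal does not change the product of
weights. -/
lemma infinitePi_rev_preimage {p : Fin 2 → ℝ} [IsProbabilityMeasure (letterMeasure p)]
    (hp : IsPosProbVec p) (n : ℕ) (η : Fin n → Fin 2) :
    Measure.infinitePi (fun _ : ℕ => letterMeasure p)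
      ((fun (ω : ℕ → Fin 2) (i : Fin n) => ω (i.rev : ℕ)) ⁻¹' {η}) =
      ENNReal.ofReal (∏ i, p (η i)) := by
  have e : ((fun (ω : ℕ → Fin 2) (i : Fin n) => ω (i.rev : ℕ)) ⁻¹' {η}) =
      Set.pi (Finset.range n : Finset ℕ)
        (fun k => {if h : k < n then η (Fin.rev ⟨k, h⟩) else 0}) := by
    ext ω
    simp only [mem_preimage, mem_singleton_iff, funext_iff, Set.mem_pi, Finset.coe_range, mem_Iio]
    constructor
    · intro h k hk
      rw [dif_pos hk, ← h]
      simp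
    · intro h i
      rw [h _ i.rev.2, dif_pos i.rev.2]
      exact congrArg η (Fin.rev_rev i)
  rw [e, Measure.infinitePi_pi _ fun k _ => measurableSet_singleton _]
  simp only [letterMeasure_singleton]
  rw [Finset.prod_range, ← ENNReal.ofReal_prod_of_nonneg fun i _ => (hp.1 _).le]
  congr 1
  exact Fintype.prod_equiv Fin.revPerm _ _ fun i => by simp

lemma integral_infinitePi_wordBranch {p : Fin 2 → ℝ} [IsProbabilityMeasure (letterMeasure p)]
    (hp : IsPosProbVec p) (n : ℕ) (h : ℝ → ℝ) (t : ℝ) :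
    ∫ ω, h (wordBranch 2 n (fun i => ω (i.rev : ℕ)) t)
      ∂Measure.infinitePi (fun _ : ℕ => letterMeasure p) = wordAverage p n h t := by
  have hm : Measurable (fun (ω : ℕ → Fin 2) (i : Fin n) => ω (i.rev : ℕ)) := by fun_prop
  have hmap := integral_map (μ := Measure.infinitePi (fun _ : ℕ => letterMeasure p))
    hm.aemeasurable (f := fun η => h (wordBranch 2 n η t))
    (measurable_of_finite _).aestronglyMeasurable
  have := Measure.isProbabilityMeasure_map (μ := Measure.infinitePi
    (fun _ : ℕ => letterMeasure p)) hm.aemeasurable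
  rw [← hmap, integral_fintype .of_finite, wordAverage]
  refine Finset.sum_congr rfl fun η _ => ?_
  rw [measureReal_def, Measure.map_apply hm (measurableSet_singleton _),
    infinitePi_rev_preimage hp, ENNReal.toReal_ofReal (Finset.prod_nonneg fun i _ => (hp.1 _).le),
    smul_eq_mul]

lemma wordAverage_succ (p : Fin 2 → ℝ) (n : ℕ) (h : ℝ → ℝ) (t : ℝ) :
    wordAverage p (n + 1) h t = ∑ j, p j * wordAverage p n (fun x => h (branch 2 j x)) t := by
  simp only [wordAverage, Finset.mul_sum]
  rw [← Fintype.sum_prod_type' (f := fun (j : Fin 2) (η : Fin n → Fin 2) =>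
    p j * ((∏ i, p (η i)) * h (branch 2 j (wordBranch 2 n η t))))]
  symm
  refine Fintype.sum_equiv (Fin.snocEquiv fun _ => Fin 2) _ _ fun x => ?_
  simp [Fin.snocEquiv, Fin.prod_univ_castSucc, wordBranch]
  ring

/-- `m` is the limit distribution of the weighted preimages of a point under doubling. -/
structure IsDigitMeasure (p : Fin 2 → ℝ) (m : Measure ℝ) : Prop where
  isProbabilityMeasure : IsProbabilityMeasure m
  ae_mem : ∀ᵐ x ∂m, x ∈ Icc (0 : ℝ) 1
  tendsto : ∀ h : ℝ → ℝ, Continuous h → ∀ t ∈ Icc (0 : ℝ) 1,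
    Tendsto (fun n => wordAverage p n h t) atTop (𝓝 (∫ x, h x ∂m))

/-- The measure is the law of a binary number with independent digits. Reversing a word preserves
its probability, so the averages are integrals along prefixes, and dominated convergence applies. -/
lemma exists_isDigitMeasure {p : Fin 2 → ℝ} (hp : IsPosProbVec p) : ∃ m, IsDigitMeasure p m := by
  have := hp.isProbabilityMeasure
  set P := Measure.infinitePi (fun _ : ℕ => letterMeasure p)
  have hX : Measurable (Real.ofDigits (b := 2)) := Real.continuous_ofDigits.measurable
  refine ⟨P.map Real.ofDigits, Measure.isProbabilityMeasure_map hX.aemeasurable, ?_, ?_⟩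
  · refine (ae_map_iff hX.aemeasurable measurableSet_Icc).2 (.of_forall ?_)
    exact fun ω => ⟨Real.ofDigits_nonneg ω, Real.ofDigits_le_one ω⟩
  · intro h hh t ht
    rw [integral_map hX.aemeasurable hh.aestronglyMeasurable]
    simp_rw [← integral_infinitePi_wordBranch hp]
    obtain ⟨B, hB⟩ := isCompact_Icc.exists_bound_of_continuousOn (hh.continuousOn (s := Icc 0 1))
    refine tendsto_integral_of_dominated_convergence (fun _ => B) (fun n => ?_)
      (integrable_const _) (fun n => .of_forall fun ω => hB _ (wordBranch_mem_Icc ht n _))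
      (.of_forall fun ω => ?_)
    · have hm : Measurable (fun (ω : ℕ → Fin 2) (i : Fin n) => ω (i.rev : ℕ)) := by fun_prop
      exact ((measurable_of_finite fun η : Fin n → Fin 2 =>
        h (wordBranch 2 n η t)).comp hm).aestronglyMeasurable
    · refine (hh.tendsto _).comp ?_
      rw [tendsto_iff_norm_sub_tendsto_zero]
      exact squeeze_zero (fun _ => norm_nonneg _)
        (fun n => abs_wordBranch_sub_ofDigits_le ht n ω)
        (tendsto_pow_atTop_nhds_zero_of_lt_one (by norm_num) (by norm_num))

variable {p : Fin 2 → ℝ} {m : Measure ℝ}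

lemma continuous_branch (j : Fin 2) : Continuous (branch 2 j) := by
  unfold branch; fun_prop

lemma IsDigitMeasure.integral_eq (hm : IsDigitMeasure p m) {h : ℝ → ℝ} (hh : Continuous h) :
    ∫ x, h x ∂m = ∑ j, p j * ∫ x, h (branch 2 j x) ∂m := by
  have h1 := (tendsto_add_atTop_iff_nat 1).2 (hm.tendsto h hh 0 (by simp))
  refine tendsto_nhds_unique h1 ?_
  simp_rw [wordAverage_succ]
  exact tendsto_finsetSum _ fun j _ =>
    (hm.tendsto _ (hh.comp (continuous_branch j)) 0 (by simp)).const_mul _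

lemma IsDigitMeasure.integrable (hm : IsDigitMeasure p m) {h : ℝ → ℝ} (hh : Continuous h) :
    Integrable h m := by
  have := hm.isProbabilityMeasure
  obtain ⟨B, hB⟩ := isCompact_Icc.exists_bound_of_continuousOn (hh.continuousOn (s := Icc 0 1))
  refine Integrable.of_bound hh.aestronglyMeasurable B ?_
  filter_upwards [hm.ae_mem] with x hx using hB x hx

/-- Self-similarity gives the equation M = (M + p 1) / 2 for the mean M. -/
lemma IsDigitMeasure.integral_id (hp : IsPosProbVec p) (hm : IsDigitMeasure p m) :
    ∫ x, x ∂m = p 1 := by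
  have := hm.isProbabilityMeasure
  have h1 := hm.integral_eq continuous_id
  have hi : Integrable (fun x : ℝ => x) m := hm.integrable continuous_id
  have h2 : ∀ j : Fin 2, ∫ x, id (branch 2 j x) ∂m = ((∫ x, x ∂m) + (j : ℕ)) / 2 := fun j => by
    simp only [id, branch]
    push_cast
    rw [integral_div, integral_add hi (integrable_const _)]
    simp
  have hs := hp.2
  rw [Fin.sum_univ_two] at hs
  simp only [h2, Fin.sum_univ_two, Fin.val_zero, Fin.val_one, Nat.cast_zero, Nat.cast_one] at h1
  simp only [id] at h1
  linear_combination 2 * h1 + (∫ x, x ∂m) * hs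

lemma IsDigitMeasure.integral_abs_sub (hp : IsPosProbVec p) (hm : IsDigitMeasure p m) (j : Fin 2) :
    ∫ x, |x - (j : ℕ)| ∂m = 1 - p j := by
  have := hm.isProbabilityMeasure
  have hi : Integrable (fun x : ℝ => x) m := hm.integrable continuous_id
  have hs := hp.2
  rw [Fin.sum_univ_two] at hs
  have hid := hm.integral_id hp
  fin_cases j
  · have e : ∫ x, |x - ((⟨0, by norm_num⟩ : Fin 2) : ℕ)| ∂m = ∫ x, x ∂m := by
      refine integral_congr_ae ?_
      filter_upwards [hm.ae_mem] with x hx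
      simp [abs_of_nonneg hx.1]
    simp only [Fin.zero_eta] at e ⊢
    rw [e, hid]
    linarith
  · have e : ∫ x, |x - ((⟨1, by norm_num⟩ : Fin 2) : ℕ)| ∂m = ∫ x, (1 - x) ∂m := by
      refine integral_congr_ae ?_
      filter_upwards [hm.ae_mem] with x hx
      simp only [Nat.cast_one]
      rw [abs_sub_comm, abs_of_nonneg (by linarith [hx.2])]
    simp only [Fin.mk_one] at e ⊢
    rw [e, integral_sub (integrable_const _) hi, hid]
    simp

/-- Lets the first moment of |x - a| alone control the integral of a continuous function. -/
lemma exists_abs_sub_le_add_mul {h : ℝ → ℝ} (hh : Continuous h) (a : ℝ) {ε : ℝ} (hε : 0 < ε) :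
    ∃ M, ∀ x ∈ Icc (0 : ℝ) 1, |h x - h a| ≤ ε + M * |x - a| := by
  obtain ⟨δ, hδ, hd⟩ := Metric.continuous_iff.1 hh a ε hε
  obtain ⟨B, hB⟩ := isCompact_Icc.exists_bound_of_continuousOn
    ((hh.sub (continuous_const (y := h a))).continuousOn (s := Icc (0 : ℝ) 1))
  have hB0 : 0 ≤ B := (norm_nonneg _).trans (hB 0 (by simp))
  refine ⟨B / δ, fun x hx => ?_⟩
  rcases lt_or_ge (dist x a) δ with h1 | h1
  · have h2 := hd x h1
    rw [Real.dist_eq] at h2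
    have : 0 ≤ B / δ * |x - a| := by positivity
    linarith
  · rw [Real.dist_eq] at h1
    have h2 : B ≤ B / δ * |x - a| := by
      calc B = B / δ * δ := by field_simp
        _ ≤ _ := by gcongr
    have h3 : |h x - h a| ≤ B := hB x hx
    linarith

lemma tendsto_integral_weightToOne {m : (Fin 2 → ℝ) → Measure ℝ}
    (hm : ∀ p, IsPosProbVec p → IsDigitMeasure p (m p)) {h : ℝ → ℝ} (hh : Continuous h)
    (j : Fin 2) :
    Tendsto (fun p => ∫ x, h x ∂m p) (weightToOne j) (𝓝 (h (j : ℕ))) := by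
  rw [Metric.tendsto_nhds]
  intro ε hε
  obtain ⟨M, hM⟩ := exists_abs_sub_le_add_mul hh (j : ℕ) (half_pos hε)
  have hpj : Tendsto (fun p : Fin 2 → ℝ => M * (1 - p j)) (weightToOne j) (𝓝 0) := by
    have h1 : Tendsto (fun p : Fin 2 → ℝ => p j) (weightToOne j) (𝓝 1) :=
      (tendsto_comap.mono_left inf_le_left).mono_right nhdsWithin_le_nhds
    simpa using (h1.const_sub 1).const_mul M
  have hpos : ∀ᶠ p in weightToOne j, IsPosProbVec p := mem_inf_of_right (mem_principal_self _)
  filter_upwards [hpos, hpj.eventually (gt_mem_nhds (half_pos hε))] with p hp h1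
  have hm' := hm p hp
  have := hm'.isProbabilityMeasure
  rw [Real.dist_eq]
  have e : ∫ x, h x ∂m p - h (j : ℕ) = ∫ x, (h x - h (j : ℕ)) ∂m p := by
    rw [integral_sub (hm'.integrable hh) (integrable_const _)]
    simp
  have hint : Integrable (fun x : ℝ => ε / 2 + M * |x - (j : ℕ)|) (m p) :=
    hm'.integrable (by fun_prop)
  have hint' : Integrable (fun x : ℝ => |x - (j : ℕ)|) (m p) := hm'.integrable (by fun_prop)
  calc |∫ x, h x ∂m p - h (j : ℕ)| ≤ ∫ x, |h x - h (j : ℕ)| ∂m p := by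
        rw [e]; exact abs_integral_le_integral_abs
    _ ≤ ∫ x, (ε / 2 + M * |x - (j : ℕ)|) ∂m p := by
        refine integral_mono_ae (hm'.integrable (by fun_prop)) hint ?_
        filter_upwards [hm'.ae_mem] with x hx using hM x hx
    _ = ε / 2 + M * (1 - p j) := by
        rw [integral_add (integrable_const _) (hint'.const_mul M), integral_const_mul,
          hm'.integral_abs_sub hp]
        simp
    _ < ε := by linarith

end DigitMeasure

/-! ### The Lyubich measure as the image of the digit measure -/

section Lyubich

variable {f : ℂ → ℂ} {Φ : Circle → ℂ} {p : Fin 2 → ℝ} {m : Measure ℝ}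

/-- The parametrisation of the Julia set by the angle. -/
noncomputable def angleParam (Φ : Circle → ℂ) (x : ℝ) : ℂ := Φ (Circle.exp (2 * Real.pi * x))

lemma IsCircleConjugacy.continuous_angleParam (hΦ : IsCircleConjugacy 2 f Φ) :
    Continuous (angleParam Φ) :=
  hΦ.continuous.comp (Circle.exp.continuous.comp (by fun_prop))

lemma measurableSet_julia (f : ℂ → ℂ) : MeasurableSet (julia f) :=
  isClosed_frontier.measurableSet

lemma angleParam_mem (hΦ : IsCircleConjugacy 2 f Φ) (x : ℝ) : angleParam Φ x ∈ julia f := by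
  rw [← hΦ.range_eq]
  exact mem_range_self _

lemma map_angleParam_branch (hΦ : IsCircleConjugacy 2 f Φ) (j : Fin 2) (x : ℝ) :
    f (angleParam Φ (branch 2 j x)) = angleParam Φ x := by
  rw [angleParam, ← hΦ.semiconj, angleParam, sq, ← Circle.exp_add]
  have e : 2 * Real.pi * branch 2 j x + 2 * Real.pi * branch 2 j x =
      2 * Real.pi * x + (j : ℕ) * (2 * Real.pi) := by
    simp only [branch]
    push_cast
    ring
  rw [e, Circle.periodic_exp.nat_mul]

lemma integral_preimageMeasure (hp : IsPosProbVec p) (g : BoundedContinuousFunction ℂ ℝ) (t : ℝ)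
    (n : ℕ) : ∫ z, g z ∂(preimageMeasure Φ p t n) =
      wordAverage p n (fun x => g (angleParam Φ x)) t := by
  rw [preimageMeasure, integral_finsetSum_measure]
  · refine Finset.sum_congr rfl fun η _ => ?_
    rw [integral_smul_measure, integral_dirac,
      ENNReal.toReal_ofReal (Finset.prod_nonneg fun i _ => (hp.1 _).le), smul_eq_mul]
    rfl
  · intro η _
    exact (integrable_dirac (by simp)).smul_measure ENNReal.ofReal_ne_top

/-- Invariance is self-similarity of the digit measure: f undoes each branch, so the weights simply
sum to 1. -/
lemma IsDigitMeasure.isWeightedLyubich (hf : Continuous f) (hΦ : IsCircleConjugacy 2 f Φ)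
    (hp : IsPosProbVec p) (hm : IsDigitMeasure p m) :
    IsWeightedLyubich f Φ p (m.map (angleParam Φ)) := by
  have := hm.isProbabilityMeasure
  have hc := hΦ.continuous_angleParam
  have hpm : IsProbabilityMeasure (m.map (angleParam Φ)) :=
    Measure.isProbabilityMeasure_map hc.aemeasurable
  refine ⟨hpm, ?_, ?_, ?_⟩
  · rw [Measure.map_apply hc.measurable (measurableSet_julia f).compl]
    have : angleParam Φ ⁻¹' (julia f)ᶜ = ∅ :=
      eq_empty_of_forall_notMem fun x hx => hx (angleParam_mem hΦ x)
    rw [this, measure_empty]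
  · have hpf : IsProbabilityMeasure ((m.map (angleParam Φ)).map f) :=
      Measure.isProbabilityMeasure_map hf.aemeasurable
    refine ext_of_forall_integral_eq_of_IsFiniteMeasure fun g => ?_
    rw [integral_map hf.aemeasurable g.continuous.aestronglyMeasurable,
      integral_map (f := fun z => g (f z)) hc.aemeasurable
        (g.continuous.comp hf).aestronglyMeasurable,
      integral_map hc.aemeasurable g.continuous.aestronglyMeasurable,
      hm.integral_eq (h := fun x => g (f (angleParam Φ x))) (g.continuous.comp (hf.comp hc))]
    simp only [map_angleParam_branch hΦ]
    rw [← Finset.sum_mul, hp.2, one_mul]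
  · intro t ht g
    rw [integral_map hc.aemeasurable g.continuous.aestronglyMeasurable]
    simp_rw [integral_preimageMeasure hp]
    exact hm.tendsto _ (g.continuous.comp hc) t (Ico_subset_Icc_self ht)

lemma IsWeightedLyubich.unique {μ ν : Measure ℂ} (hμ : IsWeightedLyubich f Φ p μ)
    (hν : IsWeightedLyubich f Φ p ν) : ν = μ := by
  have := hμ.isProbabilityMeasure
  have := hν.isProbabilityMeasure
  refine ext_of_forall_integral_eq_of_IsFiniteMeasure fun g => ?_
  exact tendsto_nhds_unique (hν.tendsto 0 (by simp) g) (hμ.tendsto 0 (by simp) g)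

lemma restrict_julia_map (hΦ : IsCircleConjugacy 2 f Φ) :
    (m.map (angleParam Φ)).restrict (julia f) = m.map (angleParam Φ) := by
  have hc := hΦ.continuous_angleParam
  exact Measure.restrict_eq_self_of_ae_mem
    ((ae_map_iff hc.aemeasurable (measurableSet_julia f)).2 (.of_forall (angleParam_mem hΦ)))

lemma lyapunov_map (hΦ : IsCircleConjugacy 2 f Φ) :
    lyapunov f (m.map (angleParam Φ)) =
      - ∫ x, Real.log ‖deriv f (angleParam Φ x)‖ ∂m := by
  rw [lyapunov, restrict_julia_map hΦ, integral_map hΦ.continuous_angleParam.aemeasurable]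
  exact (Real.measurable_log.comp (measurable_deriv f).norm).aestronglyMeasurable

lemma IsDigitMeasure.integrableOn_log (hΦ : IsCircleConjugacy 2 f Φ) (hm : IsDigitMeasure p m)
    (hlog : Continuous fun x => Real.log ‖deriv f (angleParam Φ x)‖) :
    IntegrableOn (fun z => Real.log ‖deriv f z‖) (julia f) (m.map (angleParam Φ)) := by
  rw [IntegrableOn, restrict_julia_map hΦ]
  refine (integrable_map_measure
    (Real.measurable_log.comp (measurable_deriv f).norm).aestronglyMeasurable
    hΦ.continuous_angleParam.aemeasurable).2 (hm.integrable hlog)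

end Lyubich

end QuadLyap

namespace QuadLyap

/-! ### Expansion of the multiplier at the fixed point -/

section FixedPoint

/-- Put a = 1 - b, so ab = c. Since |b| > 1/2, |a| ≤ 2|c|, and log b = log(1 - a) is expanded to
second order. -/
lemma abs_log_fixedPoint_small {c b : ℂ} (hc : ‖c‖ ≤ 1 / 8) (hb : b ^ 2 + c = b)
    (hb1 : 1 < ‖2 * b‖) :
    |-Real.log ‖2 * b‖ - (-Real.log 2 + (c + 3 / 2 * c ^ 2).re)| ≤ 32 * ‖c‖ ^ 3 := by
  have hb2 : 1 / 2 < ‖b‖ := by rw [norm_mul, Complex.norm_ofNat] at hb1; linarith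
  have hb0 : ‖b‖ ≠ 0 := by linarith
  set a := 1 - b with ha
  have hab : a * b = c := by rw [ha]; linear_combination -hb
  have han : ‖a‖ ≤ 2 * ‖c‖ := by
    rw [← hab, norm_mul]
    nlinarith [norm_nonneg a]
  have ha4 : ‖a‖ ≤ 1 / 4 := by linarith
  have hT := Complex.norm_log_sub_logTaylor_le 2 (z := -a) (by rw [norm_neg]; linarith)
  have hba : 1 + -a = b := by rw [ha]; ring
  have htay : Complex.logTaylor 3 (-a) = -a - a ^ 2 / 2 := by
    simp [Complex.logTaylor, Finset.sum_range_succ]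
    ring
  rw [hba, htay, norm_neg] at hT
  have hT' : ‖Complex.log b - (-a - a ^ 2 / 2)‖ ≤ 4 * ‖c‖ ^ 3 := by
    refine hT.trans ?_
    have h1 : (1 - ‖a‖)⁻¹ ≤ 4 / 3 := by
      rw [inv_le_comm₀ (by linarith) (by norm_num)]
      linarith
    have h2 : ‖a‖ ^ 3 ≤ 8 * ‖c‖ ^ 3 := by
      calc ‖a‖ ^ 3 ≤ (2 * ‖c‖) ^ 3 := by gcongr
        _ = _ := by ring
    have h0 : 0 ≤ (1 - ‖a‖)⁻¹ := inv_nonneg.2 (by linarith)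
    have h3 : ‖a‖ ^ 3 * (1 - ‖a‖)⁻¹ ≤ 8 * ‖c‖ ^ 3 * (4 / 3) := by gcongr
    have h4 : 0 ≤ ‖c‖ ^ 3 := by positivity
    norm_num at h3 ⊢
    linarith
  have hrem : ‖(a + a ^ 2 / 2) - (c + 3 / 2 * c ^ 2)‖ ≤ 18 * ‖c‖ ^ 3 := by
    -- Since c = a - a², the difference is 3/2 (a² - c²), which is of third order.
    have e : (a + a ^ 2 / 2) - (c + 3 / 2 * c ^ 2) = 3 / 2 * (a ^ 2 * (a + c)) := by
      have h1 : c = a - a ^ 2 := by rw [ha]; linear_combination hb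
      rw [h1]; ring
    rw [e, norm_mul, norm_mul, norm_pow]
    have h1 : ‖(3 / 2 : ℂ)‖ = 3 / 2 := by norm_num
    have h2 : ‖a + c‖ ≤ 3 * ‖c‖ := (norm_add_le _ _).trans (by linarith)
    rw [h1]
    calc (3 / 2 : ℝ) * (‖a‖ ^ 2 * ‖a + c‖) ≤ 3 / 2 * ((2 * ‖c‖) ^ 2 * (3 * ‖c‖)) := by gcongr
      _ = _ := by ring
  have hlog : Real.log ‖2 * b‖ = Real.log 2 + (Complex.log b).re := by
    rw [norm_mul, Complex.norm_ofNat, Real.log_mul two_ne_zero hb0, Complex.log_re]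
  have e : -Real.log ‖2 * b‖ - (-Real.log 2 + (c + 3 / 2 * c ^ 2).re) =
      (((a + a ^ 2 / 2) - (c + 3 / 2 * c ^ 2)) - (Complex.log b - (-a - a ^ 2 / 2))).re := by
    rw [hlog]
    have : ((a + a ^ 2 / 2) - (c + 3 / 2 * c ^ 2)) - (Complex.log b - (-a - a ^ 2 / 2)) =
      -Complex.log b - (c + 3 / 2 * c ^ 2) := by ring
    rw [this, Complex.sub_re, Complex.neg_re]
    ring
  rw [e]
  refine (Complex.abs_re_le_norm _).trans ((norm_sub_le _ _).trans ?_)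
  have h4 : 0 ≤ ‖c‖ ^ 3 := by positivity
  linarith

lemma abs_log_fixedPoint_sub_le {c b : ℂ} (hc : ‖c‖ ≤ 1) (hb : b ^ 2 + c = b)
    (hb1 : 1 < ‖2 * b‖) (hb2 : ‖b‖ ≤ 2) :
    |-Real.log ‖2 * b‖ - (-Real.log 2 + (c + 3 / 2 * c ^ 2).re)| ≤ 4096 * ‖c‖ ^ 3 := by
  have h0 : 0 ≤ ‖c‖ ^ 3 := by positivity
  rcases le_or_gt ‖c‖ (1 / 8) with h | h
  · exact (abs_log_fixedPoint_small h hb hb1).trans (by linarith)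
  -- Here |c|³ > 1/512, and 4096 = 8 · 512, so bounding the left side by 8 is enough.
  · have h1 : (1 / 8 : ℝ) ^ 3 ≤ ‖c‖ ^ 3 := by gcongr
    have h2 : ‖2 * b‖ ≤ 4 := by rw [norm_mul, Complex.norm_ofNat]; linarith
    have h3 : 0 < Real.log ‖2 * b‖ := Real.log_pos hb1
    have h4 : Real.log ‖2 * b‖ ≤ 3 := by
      have := Real.log_le_sub_one_of_pos (zero_lt_one.trans hb1)
      linarith
    have h5 : 0 < Real.log 2 := Real.log_pos one_lt_two
    have h6 : Real.log 2 ≤ 1 := by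
      have := Real.log_le_sub_one_of_pos (zero_lt_two (α := ℝ))
      linarith
    have h7 : |(c + 3 / 2 * c ^ 2).re| ≤ 5 / 2 := by
      refine (Complex.abs_re_le_norm _).trans ((norm_add_le _ _).trans ?_)
      have e : ‖(3 / 2 : ℂ)‖ = 3 / 2 := by norm_num
      rw [norm_mul, norm_pow, e]
      nlinarith [norm_nonneg c]
    rw [abs_le] at h7 ⊢
    norm_num at h1
    constructor <;> linarith [h7.1, h7.2]

end FixedPoint

end QuadLyap

namespace QuadLyap

/-! ### Fixed point, integrability and assembly -/

section Main

variable {c : ℂ} {Φ : Circle → ℂ}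

lemma R₂_eq_quad (α β : ℝ) : R₂ α β = quad (α + β * Complex.I) := rfl

lemma norm_add_mul_I (α β : ℝ) : ‖(α + β * Complex.I : ℂ)‖ = Real.sqrt (α ^ 2 + β ^ 2) :=
  Complex.norm_add_mul_I α β

lemma deriv_quad (c z : ℂ) : deriv (quad c) z = 2 * z := by
  unfold quad
  simp

lemma deriv_iterate_quad_fixed {b : ℂ} (hb : quad c b = b) (n : ℕ) :
    deriv ((quad c)^[n]) b = (2 * b) ^ n := by
  have h : HasDerivAt (quad c) (2 * b) b := by
    rw [← deriv_quad c]
    exact (show DifferentiableAt ℂ (quad c) b by unfold quad; fun_prop).hasDerivAt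
  exact (HasDerivAt.iterate b h hb n).deriv

/-- At a fixed point the derivative of the N-th iterate is (2b)^N, whose modulus cannot exceed 1 if
|2b| ≤ 1. -/
lemma IsHyperbolic.one_lt_norm_of_fixed (hyp : IsHyperbolic (quad c)) {b : ℂ}
    (hbJ : b ∈ julia (quad c)) (hb : quad c b = b) : 1 < ‖2 * b‖ := by
  obtain ⟨N, -, hN⟩ := hyp.exists_expanding
  have h := hN b hbJ
  rw [deriv_iterate_quad_fixed hb, norm_pow] at h
  by_contra! hle
  linarith [pow_le_one₀ (n := N) (norm_nonneg (2 * b)) hle]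

lemma IsHyperbolic.deriv_ne_zero (hyp : IsHyperbolic (quad c)) {z : ℂ}
    (hz : z ∈ julia (quad c)) : deriv (quad c) z ≠ 0 := by
  obtain ⟨C, hC, lam, hlam, h⟩ := hyp
  have h1 := h z hz 1 le_rfl
  rw [Function.iterate_one, pow_one] at h1
  exact norm_pos_iff.1 (lt_of_lt_of_le (by positivity) h1)

lemma IsCircleConjugacy.quad_fixed (hΦ : IsCircleConjugacy 2 (quad c) Φ) :
    quad c (Φ 1) = Φ 1 := by
  rw [← hΦ.semiconj, one_pow]

lemma IsHyperbolic.continuous_log (hyp : IsHyperbolic (quad c))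
    (hΦ : IsCircleConjugacy 2 (quad c) Φ) :
    Continuous fun x => Real.log ‖deriv (quad c) (angleParam Φ x)‖ := by
  refine Continuous.log ?_ fun x => norm_ne_zero_iff.2 (hyp.deriv_ne_zero (angleParam_mem hΦ x))
  simp_rw [deriv_quad]
  exact (continuous_const.mul hΦ.continuous_angleParam).norm

/-- Used for n = 0 and n = 1: the two limit points of the digit measures give the same point of the
Julia set, hence a common limit L. -/
lemma angleParam_natCast (Φ : Circle → ℂ) (n : ℕ) : angleParam Φ n = Φ 1 := by
  have h := Circle.periodic_exp.nat_mul n 0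
  rw [zero_add, Circle.exp_zero, mul_comm] at h
  rw [angleParam, h]

end Main

end QuadLyap

theorem mainTheorem3 :
    ∃ K : ℝ, ∀ α β : ℝ, α ^ 2 + β ^ 2 < 1 →
      QuadLyap.IsHyperbolic (QuadLyap.R₂ α β) →
      QuadLyap.HasBoundedCriticalOrbit (QuadLyap.R₂ α β) →
      ∃ Φ : Circle → ℂ,
        QuadLyap.IsCircleConjugacy 2 (QuadLyap.R₂ α β) Φ ∧
        (∀ Φ' : Circle → ℂ, QuadLyap.IsCircleConjugacy 2 (QuadLyap.R₂ α β) Φ' → Φ' = Φ) ∧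
        ∃ μ : (Fin 2 → ℝ) → Measure ℂ,
          (∀ p : Fin 2 → ℝ, QuadLyap.IsPosProbVec p →
            QuadLyap.IsWeightedLyubich (QuadLyap.R₂ α β) Φ p (μ p) ∧
            (∀ ν : Measure ℂ,
              QuadLyap.IsWeightedLyubich (QuadLyap.R₂ α β) Φ p ν → ν = μ p) ∧
            IntegrableOn (fun z => Real.log ‖deriv (QuadLyap.R₂ α β) z‖)
              (QuadLyap.julia (QuadLyap.R₂ α β)) (μ p)) ∧
          ∃ L : ℝ,
            (∀ j : Fin 2,
              Tendsto (fun p => QuadLyap.lyapunov (QuadLyap.R₂ α β) (μ p))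
                (QuadLyap.weightToOne j) (𝓝 L)) ∧
            |L - (-Real.log 2 + α + 3 / 2 * (α ^ 2 - β ^ 2))|
              ≤ K * Real.sqrt (α ^ 2 + β ^ 2) ^ 3 := by
  refine ⟨4096, fun α β hαβ hyp hcrit => ?_⟩
  rw [QuadLyap.R₂_eq_quad] at *
  set c : ℂ := α + β * Complex.I with hcdef
  have hcn : ‖c‖ = Real.sqrt (α ^ 2 + β ^ 2) := QuadLyap.norm_add_mul_I α β
  have hc : ‖c‖ ≤ 1 := by
    rw [hcn]
    exact Real.sqrt_le_one.2 hαβ.le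
  obtain ⟨Φ, hΦ⟩ := QuadLyap.exists_isCircleConjugacy hc hyp hcrit
  have hlog := hyp.continuous_log hΦ
  choose! m hm using fun p (hp : QuadLyap.IsPosProbVec p) => QuadLyap.exists_isDigitMeasure hp
  refine ⟨Φ, hΦ, fun Φ' hΦ' => hΦ'.unique hΦ, fun p => (m p).map (QuadLyap.angleParam Φ),
    fun p hp => ?_, -Real.log ‖2 * Φ 1‖, fun j => ?_, ?_⟩
  · have h := (hm p hp).isWeightedLyubich (QuadLyap.continuous_quad c) hΦ hp
    exact ⟨h, fun ν hν => h.unique hν, (hm p hp).integrableOn_log hΦ hlog⟩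
  · simp_rw [QuadLyap.lyapunov_map hΦ]
    have h := (QuadLyap.tendsto_integral_weightToOne hm hlog j).neg
    rwa [QuadLyap.angleParam_natCast, QuadLyap.deriv_quad] at h
  · have hJ : Φ 1 ∈ QuadLyap.julia (QuadLyap.quad c) := hΦ.range_eq ▸ Set.mem_range_self 1
    have h2 : ‖Φ 1‖ ≤ 2 := by
      simpa using QuadLyap.filledJulia_subset hc (QuadLyap.julia_subset_filledJulia hc hJ)
    have h := QuadLyap.abs_log_fixedPoint_sub_le hc hΦ.quad_fixed
      (hyp.one_lt_norm_of_fixed hJ hΦ.quad_fixed) h2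
    rw [hcn] at h
    have hre : (c + 3 / 2 * c ^ 2).re = α + 3 / 2 * (α ^ 2 - β ^ 2) := by
      simp [hcdef, sq, Complex.add_re, Complex.mul_re]
    rwa [hre, ← add_assoc] at h
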